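/- Consider the following single-pass streaming algorithm with rank parameter $k\ge 1$. On a stream of rows $b_1,b_2,\dots\in\mathbb R^d$ it maintains the matrix $B$ of the rows selected so far (initially empty) and $\lambda=\|B-[B]_k\|_F^2/k$, where $[B]_k$ is the best rank-$k$ approximation of $B$ in Frobenius norm. It selects the next row $b$ if either $\lambda=0$ and $b\notin\mathrm{rowspace}(B)$, or $b^{T}(B^{T}B+\lambda I)^{+}b\ge \frac{1}{1+1/k}$, where $^+$ denotes the Moore–Penrose pseudoinverse; otherwise it discards $b$. **Theorem.** There is a universal constant $C>0$ such that the following holds. Let $1\le k\le d$, let $a_1,\dots,a_n\in\mathbb R^d$ with $\|a_i\|_2<R$ for all $i$, and let $0<\delta<\min_{V}\max_{i} d(a_i,V)$, the minimum being over all $k$-dimensional subspaces $V\subseteq\mathbb R^d$, where $d(x,V)$ denotes Euclidean distance (then $k<d$). Put $t=2\sqrt{k+1}$ and $L=\max\{1,\log(kR/\delta)\}$, and run the algorithm on the stream $$(\delta/t)e_1,\dots,(\delta/t)e_{k+1},\,a_1,\dots,a_n .$$ Let $S\subseteq\{1,\dots,n\}$ be the set of all $i$ for which the row $a_i$ is selected.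 Then: 1. $|S|\le C\,k\,L^{3}$; 2. for every $k$-dimensional subspace $V\subseteq\mathbb R^d$, $\displaystyle \max_{1\le i\le n} d(a_i,V)\le C\sqrt{k}\,L^{3/2}\max_{i\in S}d(a_i,V)$; 3. at every moment of the pass, the memory of the algorithm (the selected rows with their positions, the row being read, and a fixed number of further scalars) consists of at most $C\,|S|\,d$ numbers, i.e. the space is that needed to store $O(|S|)$ rows. -/

import Mathlib

open scoped Matrix

/-! ### Distances and the `ℓ_∞` subspace approximation cost -/

/-- `max_{i ∈ T} d(a_i, V)`, where `d(x, V)` is the Euclidean distance from `x` to the subspace `V`. -/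
noncomputable def maxDist {d n : ℕ} (a : Fin n → EuclideanSpace ℝ (Fin d)) (T : Finset (Fin n))
    (V : Submodule ℝ (EuclideanSpace ℝ (Fin d))) : ℝ :=
  ⨆ i : T, Metric.infDist (a i) (V : Set (EuclideanSpace ℝ (Fin d)))

/-- The optimal cost: the minimum over all `k`-dimensional subspaces `V` of `max_i d(a_i, V)`. -/
noncomputable def optCost {d n : ℕ} (k : ℕ) (a : Fin n → EuclideanSpace ℝ (Fin d)) : ℝ :=
  ⨅ V : {V : Submodule ℝ (EuclideanSpace ℝ (Fin d)) // Module.finrank ℝ V = k},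
    maxDist a Finset.univ V.1

/-! ### Moore–Penrose pseudoinverse of a real square matrix -/

/-- The four Penrose equations: `X` is the Moore–Penrose pseudoinverse of `M`. -/
structure IsPseudoinverse {d : ℕ} (M X : Matrix (Fin d) (Fin d) ℝ) : Prop where
  mul_mul : M * X * M = M
  mul_mul' : X * M * X = X
  symm_left : (M * X)ᵀ = M * X
  symm_right : (X * M)ᵀ = X * M

theorem IsPseudoinverse.unique {d : ℕ} {M X Y : Matrix (Fin d) (Fin d) ℝ}
    (hX : IsPseudoinverse M X) (hY : IsPseudoinverse M Y) : X = Y := by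
  have h1 : M * X = M * Y := by
    calc M * X = (M * X)ᵀ := hX.symm_left.symm
      _ = ((M * Y) * (M * X))ᵀ := by
          rw [← Matrix.mul_assoc (M * Y) M X, hY.mul_mul]
      _ = (M * X)ᵀ * (M * Y)ᵀ := Matrix.transpose_mul _ _
      _ = M * X * (M * Y) := by rw [hX.symm_left, hY.symm_left]
      _ = M * Y := by rw [← Matrix.mul_assoc (M * X) M Y, hX.mul_mul]
  have h2 : X * M = Y * M := by
    calc X * M = (X * M)ᵀ := hX.symm_right.symm
      _ = ((X * M) * (Y * M))ᵀ := by
          rw [Matrix.mul_assoc X M (Y * M), ← Matrix.mul_assoc M Y M, hY.mul_mul]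
      _ = (Y * M)ᵀ * (X * M)ᵀ := Matrix.transpose_mul _ _
      _ = Y * M * (X * M) := by rw [hX.symm_right, hY.symm_right]
      _ = Y * M := by rw [Matrix.mul_assoc Y M (X * M), ← Matrix.mul_assoc M X M, hX.mul_mul]
  calc X = X * M * X := hX.mul_mul'.symm
    _ = Y * M * Y := by rw [h2, Matrix.mul_assoc, h1, ← Matrix.mul_assoc]
    _ = Y := hY.mul_mul'

/-- A symmetric matrix has a pseudoinverse (only symmetric matrices are inverted below). -/
theorem exists_isPseudoinverse {d : ℕ} {M : Matrix (Fin d) (Fin d) ℝ} (hM : M.IsSymm) :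
    ∃ X, IsPseudoinverse M X := by
  have hH : M.IsHermitian := by
    rw [Matrix.IsHermitian, Matrix.conjTranspose_eq_transpose_of_trivial]; exact hM
  obtain ⟨U, D, hU, hMU⟩ : ∃ (U : Matrix (Fin d) (Fin d) ℝ) (D : Fin d → ℝ),
      Uᵀ * U = 1 ∧ M = U * Matrix.diagonal D * Uᵀ := by
    refine ⟨hH.eigenvectorUnitary, hH.eigenvalues, ?_, ?_⟩
    · have := Unitary.coe_star_mul_self hH.eigenvectorUnitary
      rwa [Matrix.star_eq_conjTranspose, Matrix.conjTranspose_eq_transpose_of_trivial] at this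
    · have := hH.spectral_theorem
      rw [Unitary.conjStarAlgAut_apply, Matrix.star_eq_conjTranspose,
        Matrix.conjTranspose_eq_transpose_of_trivial] at this
      exact this
  have key : ∀ D E : Fin d → ℝ, U * Matrix.diagonal D * Uᵀ * (U * Matrix.diagonal E * Uᵀ)
      = U * Matrix.diagonal (fun i => D i * E i) * Uᵀ := by
    intro D E
    calc _ = U * Matrix.diagonal D * (Uᵀ * U) * Matrix.diagonal E * Uᵀ := by
          simp only [Matrix.mul_assoc]
      _ = _ := by
          rw [hU, Matrix.mul_one, Matrix.mul_assoc U, Matrix.diagonal_mul_diagonal]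
  have sym : ∀ D : Fin d → ℝ, (U * Matrix.diagonal D * Uᵀ)ᵀ = U * Matrix.diagonal D * Uᵀ := by
    intro D
    simp [Matrix.transpose_mul, Matrix.mul_assoc]
  refine ⟨U * Matrix.diagonal (fun i => (D i)⁻¹) * Uᵀ, ?_, ?_, ?_, ?_⟩ <;> subst hMU
  · rw [key, key]; congr; funext i; exact mul_inv_mul_cancel (D i)
  · rw [key, key]; congr; funext i; simpa using mul_inv_mul_cancel (D i)⁻¹
  · rw [key, sym]
  · rw [key, sym]

open Classical in
/-- The Moore–Penrose pseudoinverse `M⁺`. -/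
noncomputable def pinv {d : ℕ} (M : Matrix (Fin d) (Fin d) ℝ) : Matrix (Fin d) (Fin d) ℝ :=
  if h : ∃ X, IsPseudoinverse M X then h.choose else 0

theorem pinv_spec {d : ℕ} {M : Matrix (Fin d) (Fin d) ℝ} (hM : M.IsSymm) :
    IsPseudoinverse M (pinv M) := by
  have h := exists_isPseudoinverse hM
  rw [pinv, dif_pos h]
  exact h.choose_spec

/-! ### The streaming algorithm -/

/-- The matrix whose rows are the entries of the list. -/
def rowMatrix {d : ℕ} (l : List (EuclideanSpace ℝ (Fin d))) : Matrix (Fin l.length) (Fin d) ℝ :=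
  Matrix.of fun i j => l.get i j

/-- The rank-`k` ridge parameter `‖A - [A]_k‖_F² / k`, where `[A]_k` is the best rank-`k`
approximation of `A` in Frobenius norm. -/
noncomputable def ridgeParam {m d : ℕ} (k : ℕ) (A : Matrix (Fin m) (Fin d) ℝ) : ℝ :=
  (⨅ X : {X : Matrix (Fin m) (Fin d) ℝ // X.rank ≤ k}, ∑ i, ∑ j, (A i j - X.1 i j) ^ 2) / k

/-- The ridge leverage score `xᵀ (Aᵀ A + lam I)⁺ x`. -/
noncomputable def ridgeScore {m d : ℕ} (A : Matrix (Fin m) (Fin d) ℝ) (lam : ℝ)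
    (x : EuclideanSpace ℝ (Fin d)) : ℝ :=
  x.ofLp ⬝ᵥ (pinv (Aᵀ * A + lam • (1 : Matrix (Fin d) (Fin d) ℝ)) *ᵥ x.ofLp)

/-- What the algorithm remembers between two rows of the stream: the number of rows read so far,
the selected rows (each with its position, counted from `0`), and the ridge parameter. -/
structure CoresetState (d : ℕ) where
  clock : ℕ
  stored : List (ℕ × EuclideanSpace ℝ (Fin d))
  lam : ℝ

/-- The selected rows, in order of arrival. -/
def CoresetState.rows {d : ℕ} (s : CoresetState d) : List (EuclideanSpace ℝ (Fin d)) :=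
  s.stored.map Prod.snd

/-- Number of machine words (each one real number or one index) used while `s` is the memory of the
algorithm: a row and its position for every stored row, the row being read, and the four numbers
`clock`, `lam`, the rank parameter and the scale of the vectors that precede the input. -/
def CoresetState.words {d : ℕ} (s : CoresetState d) : ℕ :=
  s.stored.length * (d + 1) + d + 4

/-- The memory before the first row is read. -/
def initState (d : ℕ) : CoresetState d := ⟨0, [], 0⟩

/-- The row `x` gets selected if `lam = 0` and `x` is not in the row space of the selected rows, or
else if its ridge leverage score with respect to them is at least `1 / (1 + 1 / k)`. -/
def Selects {d : ℕ} (k : ℕ) (s : CoresetState d) (x : EuclideanSpace ℝ (Fin d)) : Prop :=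
  (s.lam = 0 ∧ x ∉ Submodule.span ℝ {y | y ∈ s.rows}) ∨
    1 / (1 + 1 / (k : ℝ)) ≤ ridgeScore (rowMatrix s.rows) s.lam x

open Classical in
/-- Processing one row `x` of the stream. -/
noncomputable def step {d : ℕ} (k : ℕ) (s : CoresetState d) (x : EuclideanSpace ℝ (Fin d)) :
    CoresetState d :=
  let stored' := if Selects k s x then s.stored ++ [(s.clock, x)] else s.stored
  ⟨s.clock + 1, stored', ridgeParam k (rowMatrix (stored'.map Prod.snd))⟩

/-- The memory after reading the stream `l` in a single pass. -/
noncomputable def run {d : ℕ} (k : ℕ) (l : List (EuclideanSpace ℝ (Fin d))) : CoresetState d :=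
  l.foldl (step k) (initState d)

/-- The `j`-th vector of the standard basis of `ℝ^d` (for `j < d`, counted from `0`). -/
noncomputable def stdVec (d j : ℕ) : EuclideanSpace ℝ (Fin d) :=
  WithLp.toLp 2 fun i => if (i : ℕ) = j then 1 else 0

/-- The stream `c e_1, …, c e_{k+1}, a_1, …, a_n`. -/
noncomputable def prefixedStream {d n : ℕ} (k : ℕ) (c : ℝ)
    (a : Fin n → EuclideanSpace ℝ (Fin d)) : List (EuclideanSpace ℝ (Fin d)) :=
  (List.range (k + 1)).map (fun j => c • stdVec d j) ++ List.ofFn a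

/-- The set of all `i` such that the row `a_i` gets selected from the stream
`c e_1, …, c e_{k+1}, a_1, …, a_n`. -/
noncomputable def coreset {d n : ℕ} (k : ℕ) (c : ℝ) (a : Fin n → EuclideanSpace ℝ (Fin d)) :
    Finset (Fin n) :=
  Finset.univ.filter fun i : Fin n =>
    k + 1 + (i : ℕ) ∈ (run k (prefixedStream k c a)).stored.map Prod.fst

/-! ### Residuals of a list of rows with respect to a subspace -/

/-! Write `lam` for the ridge parameter of the stored rows. By projection onto subspaces, `k * lam`
is the least sum of squared distances of the stored rows to a subspace of dimension at most `k`
(`mul_ridgeParam_le_residualCost`, `le_mul_ridgeParam`); hence `lam` never decreases. The `k + 1`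
prefix vectors are all stored and force `lam ≥ c ^ 2 / k`, so on the `a_i` only the leverage test
acts.

Size: the potential is `logDet + 3 k log lam`. At a fixed parameter, storing a row of score `τ` adds
`log (1 + τ)` to `logDet`, by the matrix determinant lemma. Raising the parameter from `μ` to `ν`
costs `logDet` at most `2 k log (ν / μ)`, because the effective dimension `∑ σ_i / (σ_i + μ)` is at
most `2 k` (`sum_div_add_le`), and shrinks a score at most by the factor `μ / ν`. So every selection
gains `log (3 / 2)` (`logDet_step`). The final potential is at most about `k log` of the total
squared length over `lam`, plus `3 k log lam` (`logDet_le`). Since that length is itself `O(|S| R ^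
2)`, solving for `|S|` gives `O(k L)`, stronger than the cubic bound required.

Quality: a discarded row has score at most `1`. Cauchy–Schwarz in the ridge inner product, tested on
the component of the row orthogonal to `V`, bounds its squared distance to `V` by the residual of
the stored rows plus `lam`, hence by twice that residual. The prefix contributes at most `δ ^ 2 / 4`
to the residual; this is absorbed because `δ` is below the optimal cost.

Memory: if `|S| ≤ k`, some `V` would contain all selected rows, and the quality bound would make its
cost zero. So `k < |S|`, and the prefix rows cost only a constant factor. -/

theorem infDist_eq_norm_sub_starProjection {d : ℕ}
    (W : Submodule ℝ (EuclideanSpace ℝ (Fin d))) (x : EuclideanSpace ℝ (Fin d)) :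
    Metric.infDist x (W : Set (EuclideanSpace ℝ (Fin d))) = ‖x - W.starProjection x‖ := by
  rw [Metric.infDist_eq_iInf, Submodule.starProjection_minimal]
  simp only [dist_eq_norm]
  rfl

theorem infDist_sq_eq {d : ℕ} (W : Submodule ℝ (EuclideanSpace ℝ (Fin d)))
    (y : EuclideanSpace ℝ (Fin d)) :
    Metric.infDist y (W : Set (EuclideanSpace ℝ (Fin d))) ^ 2
      = ‖y‖ ^ 2 - ‖W.starProjection y‖ ^ 2 := by
  rw [infDist_eq_norm_sub_starProjection, Submodule.norm_sq_eq_add_norm_sq_starProjection y W,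
    Submodule.starProjection_orthogonal_val]
  ring

/-- The sum of the squared distances of the rows in `l` to the subspace `W`. -/
noncomputable def residualCost {d : ℕ} (l : List (EuclideanSpace ℝ (Fin d)))
    (W : Submodule ℝ (EuclideanSpace ℝ (Fin d))) : ℝ :=
  (l.map fun y => Metric.infDist y (W : Set (EuclideanSpace ℝ (Fin d))) ^ 2).sum

theorem residualCost_nonneg {d : ℕ} (l : List (EuclideanSpace ℝ (Fin d)))
    (W : Submodule ℝ (EuclideanSpace ℝ (Fin d))) : 0 ≤ residualCost l W := by
  refine List.sum_nonneg ?_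
  simp only [List.mem_map, forall_exists_index, and_imp, forall_apply_eq_imp_iff₂]
  intro y _
  positivity

theorem residualCost_append {d : ℕ} (l l' : List (EuclideanSpace ℝ (Fin d)))
    (W : Submodule ℝ (EuclideanSpace ℝ (Fin d))) :
    residualCost (l ++ l') W = residualCost l W + residualCost l' W := by
  simp [residualCost]

theorem frobenius_eq_sum_norm_sq {d : ℕ} (l : List (EuclideanSpace ℝ (Fin d)))
    (g : Fin l.length → EuclideanSpace ℝ (Fin d)) :
    ∑ i, ∑ j, (rowMatrix l i j - g i j) ^ 2 = ∑ i : Fin l.length, ‖l[i.1] - g i‖ ^ 2 := by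
  refine Finset.sum_congr rfl fun i _ => ?_
  rw [EuclideanSpace.norm_sq_eq]
  simp [rowMatrix]

theorem bddBelow_frobenius {m d : ℕ} (k : ℕ) (A : Matrix (Fin m) (Fin d) ℝ) :
    BddBelow (Set.range fun X : {X : Matrix (Fin m) (Fin d) ℝ // X.rank ≤ k} =>
      ∑ i, ∑ j, (A i j - X.1 i j) ^ 2) :=
  ⟨0, by rintro _ ⟨X, rfl⟩; positivity⟩

/-- Projecting every row to `W` gives a competitor of rank at most `k`. Together with
`le_mul_ridgeParam` this turns the infimum over matrices into one over subspaces, without singular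
values. -/
theorem mul_ridgeParam_le_residualCost {d k : ℕ} (hk : 1 ≤ k) (l : List (EuclideanSpace ℝ (Fin d)))
    (W : Submodule ℝ (EuclideanSpace ℝ (Fin d))) (hW : Module.finrank ℝ W ≤ k) :
    k * ridgeParam k (rowMatrix l) ≤ residualCost l W := by
  have hk' : (0 : ℝ) < k := by exact_mod_cast hk
  rw [ridgeParam, mul_div_cancel₀ _ hk'.ne']
  set g : Fin l.length → EuclideanSpace ℝ (Fin d) := fun i => W.starProjection l[i.1] with hg
  let X : Matrix (Fin l.length) (Fin d) ℝ := Matrix.of fun i j => g i j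
  have hX : X.rank ≤ k := by
    rw [Matrix.rank_eq_finrank_span_row]
    refine le_trans ?_ hW
    refine le_trans (Submodule.finrank_mono (t := W.map
      (WithLp.linearEquiv 2 ℝ (Fin d → ℝ)).toLinearMap) ?_) (Submodule.finrank_map_le _ _)
    rw [Submodule.span_le]
    rintro _ ⟨i, rfl⟩
    exact ⟨g i, W.starProjection_apply_mem _, rfl⟩
  refine (ciInf_le (bddBelow_frobenius k (rowMatrix l)) ⟨X, hX⟩).trans (le_of_eq ?_)
  refine (frobenius_eq_sum_norm_sq l g).trans ?_
  rw [residualCost, ← Fin.sum_univ_fun_getElem]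
  simp only [infDist_eq_norm_sub_starProjection, hg]

/-- The row space of a competitor `X` serves as `W`: each row of `X` lies in it, so it is at least
as far from the corresponding row of `l` as `W` is. -/
theorem le_mul_ridgeParam {d k : ℕ} (hk : 1 ≤ k) (l : List (EuclideanSpace ℝ (Fin d))) (r : ℝ)
    (h : ∀ W : Submodule ℝ (EuclideanSpace ℝ (Fin d)), Module.finrank ℝ W ≤ k → r ≤ residualCost l W) :
    r ≤ k * ridgeParam k (rowMatrix l) := by
  have hk' : (0 : ℝ) < k := by exact_mod_cast hk
  rw [ridgeParam, mul_div_cancel₀ _ hk'.ne']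
  have : Nonempty {X : Matrix (Fin l.length) (Fin d) ℝ // X.rank ≤ k} := ⟨⟨0, by simp⟩⟩
  refine le_ciInf fun X => ?_
  obtain ⟨X, hX⟩ := X
  let g : Fin l.length → EuclideanSpace ℝ (Fin d) := fun i => WithLp.toLp 2 (X i)
  let W := (Submodule.span ℝ (Set.range X.row)).map
      (WithLp.linearEquiv 2 ℝ (Fin d → ℝ)).symm.toLinearMap
  have hgW : ∀ i, g i ∈ W := fun i => ⟨X i, Submodule.subset_span ⟨i, rfl⟩, rfl⟩
  have hW : Module.finrank ℝ W ≤ k :=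
    (Submodule.finrank_map_le _ _).trans (by rwa [← Matrix.rank_eq_finrank_span_row])
  refine (h W hW).trans (le_trans ?_ (frobenius_eq_sum_norm_sq l g).ge)
  rw [residualCost, ← Fin.sum_univ_fun_getElem]
  refine Finset.sum_le_sum fun i _ => ?_
  rw [← dist_eq_norm]
  exact pow_le_pow_left₀ Metric.infDist_nonneg (Metric.infDist_le_dist_of_mem (hgW i)) 2

theorem ridgeParam_nonneg {d k : ℕ} (hk : 1 ≤ k) (l : List (EuclideanSpace ℝ (Fin d))) :
    0 ≤ ridgeParam k (rowMatrix l) := by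
  have hk' : (0 : ℝ) < k := by exact_mod_cast hk
  have := le_mul_ridgeParam hk l 0 fun W _ => residualCost_nonneg l W
  exact nonneg_of_mul_nonneg_right this hk'

theorem ridgeParam_le_append {d k : ℕ} (hk : 1 ≤ k) (l l' : List (EuclideanSpace ℝ (Fin d))) :
    ridgeParam k (rowMatrix l) ≤ ridgeParam k (rowMatrix (l ++ l')) := by
  have hk' : (0 : ℝ) < k := by exact_mod_cast hk
  refine le_of_mul_le_mul_left (le_mul_ridgeParam hk _ _ fun W hW => ?_) hk'
  rw [residualCost_append]
  linarith [mul_ridgeParam_le_residualCost hk l W hW, residualCost_nonneg l' W]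

theorem mul_ridgeParam_le_sum_norm_sq {d k : ℕ} (hk : 1 ≤ k)
    (l : List (EuclideanSpace ℝ (Fin d))) :
    k * ridgeParam k (rowMatrix l) ≤ (l.map fun y => ‖y‖ ^ 2).sum := by
  have := mul_ridgeParam_le_residualCost hk l ⊥ (by simp)
  simpa [residualCost] using this

theorem norm_starProjection_sq {d : ℕ} (W : Submodule ℝ (EuclideanSpace ℝ (Fin d)))
    (x : EuclideanSpace ℝ (Fin d)) :
    ‖W.starProjection x‖ ^ 2
      = ∑ r, (inner ℝ (stdOrthonormalBasis ℝ W r : EuclideanSpace ℝ (Fin d)) x) ^ 2 := by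
  have h := (stdOrthonormalBasis ℝ W).sum_sq_inner_right (W.orthogonalProjectionOnto x)
  rw [Submodule.starProjection_apply, ← Submodule.coe_norm, ← h]
  refine Finset.sum_congr rfl fun r _ => ?_
  rw [Submodule.coe_inner, ← Submodule.starProjection_apply,
    ← Submodule.inner_starProjection_left_eq_right,
    Submodule.starProjection_eq_self_iff.2 (stdOrthonormalBasis ℝ W r).2]

/-- A subspace captures at most its dimension of the total squared length of an orthonormal
family. -/
theorem sum_norm_starProjection_sq_le {d : ℕ} {ι : Type*} [Fintype ι]
    {v : ι → EuclideanSpace ℝ (Fin d)} (hv : Orthonormal ℝ v)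
    (W : Submodule ℝ (EuclideanSpace ℝ (Fin d))) :
    ∑ i, ‖W.starProjection (v i)‖ ^ 2 ≤ Module.finrank ℝ W := by
  simp only [norm_starProjection_sq]
  -- Bessel's inequality for `v`, applied to each unit basis vector of `W`.
  rw [Finset.sum_comm]
  calc _ ≤ ∑ r : Fin (Module.finrank ℝ W), (1 : ℝ) := by
        refine Finset.sum_le_sum fun r _ => ?_
        have := hv.sum_inner_products_le
          (stdOrthonormalBasis ℝ W r : EuclideanSpace ℝ (Fin d)) (s := Finset.univ)
        have h2 : ‖(stdOrthonormalBasis ℝ W r : EuclideanSpace ℝ (Fin d))‖ = 1 :=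
          (stdOrthonormalBasis ℝ W).orthonormal.1 r
        rw [h2, one_pow] at this
        refine le_trans (Finset.sum_le_sum fun i _ => ?_) this
        rw [real_inner_comm, Real.norm_eq_abs, sq_abs]
    _ = _ := by simp

/-! ### Spectral decomposition of the Gram matrix -/

/-- The Gram matrix `Bᵀ B` of the matrix `B` whose rows are the entries of `l`. -/
def gram {d : ℕ} (l : List (EuclideanSpace ℝ (Fin d))) : Matrix (Fin d) (Fin d) ℝ :=
  (rowMatrix l)ᵀ * rowMatrix l

theorem gram_apply {d : ℕ} (l : List (EuclideanSpace ℝ (Fin d))) (i j : Fin d) :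
    gram l i j = (l.map fun y => y i * y j).sum := by
  rw [← Fin.sum_univ_fun_getElem]
  simp [gram, Matrix.mul_apply, rowMatrix]

theorem gram_concat {d : ℕ} (l : List (EuclideanSpace ℝ (Fin d))) (x : EuclideanSpace ℝ (Fin d)) :
    gram (l ++ [x]) =
      gram l + Matrix.replicateCol Unit x.ofLp * Matrix.replicateRow Unit x.ofLp := by
  ext i j
  simp [gram_apply, Matrix.mul_apply]

theorem gram_isHermitian {d : ℕ} (l : List (EuclideanSpace ℝ (Fin d))) :
    (gram l).IsHermitian := by
  rw [Matrix.IsHermitian, Matrix.conjTranspose_eq_transpose_of_trivial, gram,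
    Matrix.transpose_mul, Matrix.transpose_transpose]

theorem gram_isSymm {d : ℕ} (l : List (EuclideanSpace ℝ (Fin d))) : (gram l).IsSymm := by
  rw [Matrix.IsSymm, gram, Matrix.transpose_mul, Matrix.transpose_transpose]

/-- An orthonormal eigenbasis of the Gram matrix. -/
noncomputable def gramBasis {d : ℕ} (l : List (EuclideanSpace ℝ (Fin d))) :
    OrthonormalBasis (Fin d) ℝ (EuclideanSpace ℝ (Fin d)) :=
  (gram_isHermitian l).eigenvectorBasis

/-- The eigenvalues of the Gram matrix. -/
noncomputable def gramEigenvalues {d : ℕ} (l : List (EuclideanSpace ℝ (Fin d))) : Fin d → ℝ :=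
  (gram_isHermitian l).eigenvalues

theorem inner_eq_dotProduct {d : ℕ} (x y : EuclideanSpace ℝ (Fin d)) :
    inner ℝ x y = x.ofLp ⬝ᵥ y.ofLp := by
  simp [EuclideanSpace.inner_eq_star_dotProduct, dotProduct_comm]

theorem dotProduct_gram_mulVec {d : ℕ} (l : List (EuclideanSpace ℝ (Fin d)))
    (x : EuclideanSpace ℝ (Fin d)) :
    x.ofLp ⬝ᵥ (gram l *ᵥ x.ofLp) = (l.map fun y => (inner ℝ y x) ^ 2).sum := by
  rw [gram, ← Matrix.mulVec_mulVec, Matrix.dotProduct_mulVec, Matrix.vecMul_transpose,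
    ← Fin.sum_univ_fun_getElem]
  refine Finset.sum_congr rfl fun i _ => ?_
  rw [inner_eq_dotProduct, sq]
  rfl

theorem inner_gramBasis_gram_mulVec {d : ℕ} (l : List (EuclideanSpace ℝ (Fin d))) (i : Fin d)
    (x : Fin d → ℝ) :
    (gramBasis l i).ofLp ⬝ᵥ (gram l *ᵥ x)
      = gramEigenvalues l i * ((gramBasis l i).ofLp ⬝ᵥ x) := by
  rw [Matrix.dotProduct_mulVec, ← Matrix.mulVec_transpose, gram_isSymm l, gramBasis,
    (gram_isHermitian l).mulVec_eigenvectorBasis, smul_dotProduct]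
  rfl

theorem dotProduct_eq_sum_gramBasis {d : ℕ} (l : List (EuclideanSpace ℝ (Fin d)))
    (x y : Fin d → ℝ) :
    x ⬝ᵥ y = ∑ i, ((gramBasis l i).ofLp ⬝ᵥ x) * ((gramBasis l i).ofLp ⬝ᵥ y) := by
  have := (gramBasis l).sum_inner_mul_inner (WithLp.toLp 2 x) (WithLp.toLp 2 y)
  simp only [inner_eq_dotProduct] at this
  rw [← this]
  exact Finset.sum_congr rfl fun i _ => by rw [dotProduct_comm x]

theorem sum_inner_sq_eq {d : ℕ} (l : List (EuclideanSpace ℝ (Fin d)))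
    (x : EuclideanSpace ℝ (Fin d)) :
    (l.map fun y => (inner ℝ y x) ^ 2).sum
      = ∑ i, gramEigenvalues l i * (inner ℝ (gramBasis l i) x) ^ 2 := by
  rw [← dotProduct_gram_mulVec, dotProduct_eq_sum_gramBasis l]
  refine Finset.sum_congr rfl fun i _ => ?_
  rw [inner_gramBasis_gram_mulVec, inner_eq_dotProduct]
  ring

theorem gramEigenvalues_eq {d : ℕ} (l : List (EuclideanSpace ℝ (Fin d))) (i : Fin d) :
    gramEigenvalues l i = (l.map fun y => (inner ℝ y (gramBasis l i)) ^ 2).sum := by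
  rw [sum_inner_sq_eq]
  simp [orthonormal_iff_ite.1 (gramBasis l).orthonormal]

theorem gramEigenvalues_nonneg {d : ℕ} (l : List (EuclideanSpace ℝ (Fin d))) (i : Fin d) :
    0 ≤ gramEigenvalues l i := by
  rw [gramEigenvalues_eq]
  refine List.sum_nonneg ?_
  simp only [List.mem_map, forall_exists_index, and_imp, forall_apply_eq_imp_iff₂]
  intro y _
  positivity

theorem sum_list_sum {α ι : Type*} [Fintype ι] (l : List α) (f : α → ι → ℝ) :
    (l.map fun y => ∑ i, f y i).sum = ∑ i, (l.map fun y => f y i).sum := by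
  simp only [← Fin.sum_univ_fun_getElem]
  exact Finset.sum_comm

theorem sum_gramEigenvalues {d : ℕ} (l : List (EuclideanSpace ℝ (Fin d))) :
    ∑ i, gramEigenvalues l i = (l.map fun y => ‖y‖ ^ 2).sum := by
  simp only [gramEigenvalues_eq, ← sum_list_sum,
    fun (y : EuclideanSpace ℝ (Fin d)) i => real_inner_comm (gramBasis l i) y,
    OrthonormalBasis.sum_sq_inner_right]

/-- This is the trace of `Bᵀ B (1 - P_W)` in the eigenbasis. `W` enters only through weights in `[0,
1]` whose sum is at most its dimension. -/
theorem residualCost_eq {d : ℕ} (l : List (EuclideanSpace ℝ (Fin d)))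
    (W : Submodule ℝ (EuclideanSpace ℝ (Fin d))) :
    residualCost l W
      = ∑ i, gramEigenvalues l i * (1 - ‖W.starProjection (gramBasis l i)‖ ^ 2) := by
  have h2 : (l.map fun y => ‖W.starProjection y‖ ^ 2).sum
      = ∑ i, gramEigenvalues l i * ‖W.starProjection (gramBasis l i)‖ ^ 2 := by
    simp only [norm_starProjection_sq, sum_list_sum, Finset.mul_sum]
    rw [Finset.sum_comm]
    refine Finset.sum_congr rfl fun r _ => ?_
    simp only [real_inner_comm _ (stdOrthonormalBasis ℝ W r : EuclideanSpace ℝ (Fin d)),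
      sum_inner_sq_eq]
  simp only [residualCost, infDist_sq_eq, mul_sub, mul_one, Finset.sum_sub_distrib, ← h2,
    sum_gramEigenvalues]
  simp only [← Fin.sum_univ_fun_getElem, Finset.sum_sub_distrib]

theorem det_gram_add {d : ℕ} (l : List (EuclideanSpace ℝ (Fin d))) (μ : ℝ) :
    (gram l + μ • (1 : Matrix (Fin d) (Fin d) ℝ)).det = ∏ i, (gramEigenvalues l i + μ) := by
  -- Up to the sign `(-1) ^ d`, the determinant is the characteristic polynomial at `-μ`.
  have h := congrArg (Polynomial.eval (-μ)) (gram_isHermitian l).charpoly_eq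
  rw [Matrix.eval_charpoly, Polynomial.eval_prod] at h
  have h1 : Matrix.scalar (Fin d) (-μ) - gram l
      = -(gram l + μ • (1 : Matrix (Fin d) (Fin d) ℝ)) := by
    rw [Matrix.scalar_apply, ← Matrix.smul_one_eq_diagonal]
    module
  have h2 : ∀ i, Polynomial.eval (-μ)
      (Polynomial.X - Polynomial.C (((gram_isHermitian l).eigenvalues i : ℝ) : ℝ))
      = (-1) * (gramEigenvalues l i + μ) := by
    intro i
    simp only [Polynomial.eval_sub, Polynomial.eval_X, Polynomial.eval_C, gramEigenvalues]
    ring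
  rw [h1, Matrix.det_neg] at h
  erw [Finset.prod_congr rfl fun i _ => h2 i] at h
  rw [Finset.prod_mul_distrib] at h
  simp only [Finset.prod_const, Finset.card_univ] at h
  exact mul_left_cancel₀ (pow_ne_zero _ (by norm_num)) h

theorem det_gram_add_pos {d : ℕ} (l : List (EuclideanSpace ℝ (Fin d))) {μ : ℝ} (hμ : 0 < μ) :
    0 < (gram l + μ • (1 : Matrix (Fin d) (Fin d) ℝ)).det := by
  rw [det_gram_add]
  exact Finset.prod_pos fun i _ => by linarith [gramEigenvalues_nonneg l i]

theorem pinv_eq_inv {d : ℕ} {A : Matrix (Fin d) (Fin d) ℝ} (hs : A.IsSymm) (hA : IsUnit A.det) :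
    pinv A = A⁻¹ := by
  have h := (pinv_spec hs).mul_mul
  have h1 : A * pinv A = 1 := by
    have := congrArg (· * A⁻¹) h
    simpa [Matrix.mul_assoc, Matrix.mul_nonsing_inv A hA] using this
  exact (Matrix.inv_eq_right_inv h1).symm

theorem pinv_gram_add {d : ℕ} (l : List (EuclideanSpace ℝ (Fin d))) {μ : ℝ} (hμ : 0 < μ) :
    pinv (gram l + μ • (1 : Matrix (Fin d) (Fin d) ℝ))
      = (gram l + μ • (1 : Matrix (Fin d) (Fin d) ℝ))⁻¹ :=
  pinv_eq_inv ((gram_isSymm l).add ((Matrix.isSymm_one).smul μ)) (det_gram_add_pos l hμ).ne'.isUnit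

theorem ridgeScore_eq {d : ℕ} (l : List (EuclideanSpace ℝ (Fin d))) {μ : ℝ} (hμ : 0 < μ)
    (x : EuclideanSpace ℝ (Fin d)) :
    ridgeScore (rowMatrix l) μ x
      = ∑ i, (inner ℝ (gramBasis l i) x) ^ 2 / (gramEigenvalues l i + μ) := by
  change x.ofLp ⬝ᵥ (pinv (gram l + μ • (1 : Matrix (Fin d) (Fin d) ℝ)) *ᵥ x.ofLp) = _
  rw [pinv_gram_add l hμ]
  set A := gram l + μ • (1 : Matrix (Fin d) (Fin d) ℝ) with hA
  have hz : A *ᵥ (A⁻¹ *ᵥ x.ofLp) = x.ofLp := by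
    rw [Matrix.mulVec_mulVec, Matrix.mul_nonsing_inv A (det_gram_add_pos l hμ).ne'.isUnit,
      Matrix.one_mulVec]
  rw [dotProduct_eq_sum_gramBasis l]
  refine Finset.sum_congr rfl fun i _ => ?_
  -- With `z = A⁻¹ x`, pairing `A z = x` with the `i`-th eigenvector gives `(σ_i + μ) ⟨v_i, z⟩ =
  -- ⟨v_i, x⟩`.
  have h1 := congrArg ((gramBasis l i).ofLp ⬝ᵥ ·) hz
  simp only [hA, Matrix.add_mulVec, dotProduct_add, inner_gramBasis_gram_mulVec,
    Matrix.smul_mulVec, Matrix.one_mulVec, dotProduct_smul, smul_eq_mul, ← add_mul] at h1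
  have hp : 0 < gramEigenvalues l i + μ := by linarith [gramEigenvalues_nonneg l i]
  rw [inner_eq_dotProduct, eq_div_iff hp.ne', ← h1, hA]
  ring

theorem det_gram_concat {d : ℕ} (l : List (EuclideanSpace ℝ (Fin d))) {μ : ℝ} (hμ : 0 < μ)
    (x : EuclideanSpace ℝ (Fin d)) :
    (gram (l ++ [x]) + μ • (1 : Matrix (Fin d) (Fin d) ℝ)).det
      = (gram l + μ • (1 : Matrix (Fin d) (Fin d) ℝ)).det
        * (1 + ridgeScore (rowMatrix l) μ x) := by
  rw [gram_concat, add_right_comm, Matrix.det_add_replicateCol_mul_replicateRow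
    (det_gram_add_pos l hμ).ne'.isUnit, Matrix.det_unique (n := Unit)]
  change _ = _ * (1 + x.ofLp ⬝ᵥ (pinv (gram l + μ • (1 : Matrix (Fin d) (Fin d) ℝ)) *ᵥ x.ofLp))
  rw [pinv_gram_add l hμ, Matrix.dotProduct_mulVec]
  rfl

/-- Cauchy–Schwarz in the eigenbasis, with weights `σ_i + μ` on `w` and their inverses on `x`. -/
theorem inner_sq_le_ridgeScore_mul {d : ℕ} (l : List (EuclideanSpace ℝ (Fin d))) {μ : ℝ}
    (hμ : 0 < μ) (x w : EuclideanSpace ℝ (Fin d)) :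
    (inner ℝ x w) ^ 2
      ≤ ridgeScore (rowMatrix l) μ x
        * ((l.map fun y => (inner ℝ y w) ^ 2).sum + μ * ‖w‖ ^ 2) := by
  rw [ridgeScore_eq l hμ, sum_inner_sq_eq, ← (gramBasis l).sum_sq_inner_right w, Finset.mul_sum,
    ← Finset.sum_add_distrib, ← (gramBasis l).sum_inner_mul_inner x w]
  have hp : ∀ i, 0 < gramEigenvalues l i + μ := fun i => by linarith [gramEigenvalues_nonneg l i]
  refine Finset.sum_sq_le_sum_mul_sum_of_sq_le_mul _ (fun i _ => ?_) (fun i _ => ?_)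
    (fun i _ => ?_)
  · have := hp i; positivity
  · rw [← add_mul]; have := hp i; positivity
  · have := (hp i).ne'
    rw [real_inner_comm x]
    exact le_of_eq (by field_simp)

/-! ### The log-determinant potential -/

/-- The logarithm of `det (I + Bᵀ B / μ)`, where `B` is the matrix with rows `l`. -/
noncomputable def logDet {d : ℕ} (l : List (EuclideanSpace ℝ (Fin d))) (μ : ℝ) : ℝ :=
  Real.log (gram l + μ • (1 : Matrix (Fin d) (Fin d) ℝ)).det - d * Real.log μ

theorem logDet_eq_sum {d : ℕ} (l : List (EuclideanSpace ℝ (Fin d))) {μ : ℝ} (hμ : 0 < μ) :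
    logDet l μ = ∑ i, Real.log (1 + gramEigenvalues l i / μ) := by
  have hp : ∀ i, 0 < gramEigenvalues l i + μ := fun i => by linarith [gramEigenvalues_nonneg l i]
  rw [logDet, det_gram_add, Real.log_prod fun i _ => (hp i).ne']
  have h : ∀ i, Real.log (1 + gramEigenvalues l i / μ)
      = Real.log (gramEigenvalues l i + μ) - Real.log μ := by
    intro i
    rw [← Real.log_div (hp i).ne' hμ.ne']
    congr 1
    field_simp
    ring
  simp [h]

theorem logDet_nonneg {d : ℕ} (l : List (EuclideanSpace ℝ (Fin d))) {μ : ℝ} (hμ : 0 < μ) :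
    0 ≤ logDet l μ := by
  rw [logDet_eq_sum l hμ]
  refine Finset.sum_nonneg fun i _ => Real.log_nonneg ?_
  have := div_nonneg (gramEigenvalues_nonneg l i) hμ.le
  linarith

theorem logDet_concat {d : ℕ} (l : List (EuclideanSpace ℝ (Fin d))) {μ : ℝ} (hμ : 0 < μ)
    (x : EuclideanSpace ℝ (Fin d)) (hx : 0 ≤ ridgeScore (rowMatrix l) μ x) :
    logDet (l ++ [x]) μ = logDet l μ + Real.log (1 + ridgeScore (rowMatrix l) μ x) := by
  rw [logDet, det_gram_concat l hμ, Real.log_mul (det_gram_add_pos l hμ).ne' (by positivity),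
    logDet]
  ring

/-- If each function `f i` of the `i`-th eigenvalue is at most `c` and at most `σ i / μ`, where `μ`
is at least the ridge parameter, then the sum of the `f i` is at most `k (c + 1)`. -/
theorem sum_le_of_ridgeParam_le {d k : ℕ} (hk : 1 ≤ k) (l : List (EuclideanSpace ℝ (Fin d)))
    {μ : ℝ} (hμ : 0 < μ) (hl : ridgeParam k (rowMatrix l) ≤ μ) {f : Fin d → ℝ} {c : ℝ}
    (hc : 0 ≤ c) (hfc : ∀ i, f i ≤ c) (hf : ∀ i, f i ≤ gramEigenvalues l i / μ) :
    ∑ i, f i ≤ k * (c + 1) := by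
  -- With `p_i = ‖P_W v_i‖ ^ 2`, bound the share `p_i` of `f i` by `c` and the share `1 - p_i` by
  -- `σ_i / μ`. The first shares total at most `k c`, the second the residual of `W` over `μ`.
  have h := le_mul_ridgeParam hk l (μ * (∑ i, f i - k * c)) fun W hW => by
    have hp : ∀ i, ‖W.starProjection (gramBasis l i)‖ ^ 2 ≤ 1 := fun i => by
      have := W.norm_starProjection_apply_le (gramBasis l i)
      rw [(gramBasis l).orthonormal.1 i] at this
      exact pow_le_one₀ (norm_nonneg _) this
    have hsum := sum_norm_starProjection_sq_le (gramBasis l).orthonormal W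
    have hWk : (Module.finrank ℝ W : ℝ) ≤ k := by exact_mod_cast hW
    calc μ * (∑ i, f i - k * c)
        ≤ μ * (∑ i, f i - ∑ i, ‖W.starProjection (gramBasis l i)‖ ^ 2 * c) := by
          rw [← Finset.sum_mul]
          gcongr
          exact hsum.trans hWk
      _ = ∑ i, μ * (f i - ‖W.starProjection (gramBasis l i)‖ ^ 2 * c) := by
          rw [← Finset.sum_sub_distrib, Finset.mul_sum]
      _ ≤ residualCost l W := by
          rw [residualCost_eq]
          refine Finset.sum_le_sum fun i _ => ?_
          have h1 : μ * f i ≤ gramEigenvalues l i := (le_div_iff₀' hμ).1 (hf i)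
          have h2 := mul_le_mul_of_nonneg_right h1 (sub_nonneg.2 (hp i))
          have h3 := mul_le_mul_of_nonneg_left (hfc i)
            (mul_nonneg hμ.le (sq_nonneg ‖W.starProjection (gramBasis l i)‖))
          linarith
  have hk' : (0 : ℝ) ≤ k := by positivity
  have h2 := h.trans (mul_le_mul_of_nonneg_left hl hk')
  have : ∑ i, f i - k * c ≤ k := le_of_mul_le_mul_left (by linarith) hμ
  linarith

/-- The sum is the effective dimension, the rate at which `logDet` falls as `log μ` grows. -/
theorem sum_div_add_le {d k : ℕ} (hk : 1 ≤ k) (l : List (EuclideanSpace ℝ (Fin d)))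
    {μ : ℝ} (hμ : 0 < μ) (hl : ridgeParam k (rowMatrix l) ≤ μ) :
    ∑ i, gramEigenvalues l i / (gramEigenvalues l i + μ) ≤ 2 * k := by
  have hn := gramEigenvalues_nonneg l
  have := sum_le_of_ridgeParam_le hk l hμ hl (c := 1)
    (f := fun i => gramEigenvalues l i / (gramEigenvalues l i + μ)) zero_le_one
    (fun i => div_le_one_of_le₀ (by linarith) (by linarith [hn i]))
    (fun i => div_le_div_of_nonneg_left (hn i) hμ (by linarith [hn i]))
  linarith

theorem logDet_le {d k : ℕ} (hk : 1 ≤ k) (l : List (EuclideanSpace ℝ (Fin d)))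
    {μ : ℝ} (hμ : 0 < μ) (hl : ridgeParam k (rowMatrix l) ≤ μ) :
    logDet l μ ≤ k * (Real.log (1 + (l.map fun y => ‖y‖ ^ 2).sum / μ) + 1) := by
  have hn := gramEigenvalues_nonneg l
  have hd : ∀ i, 0 ≤ gramEigenvalues l i / μ := fun i => div_nonneg (hn i) hμ.le
  have hT : ∀ i, gramEigenvalues l i ≤ (l.map fun y => ‖y‖ ^ 2).sum := fun i => by
    rw [← sum_gramEigenvalues]
    exact Finset.single_le_sum (fun j _ => hn j) (Finset.mem_univ i)
  have hT0 : 0 ≤ (l.map fun y => ‖y‖ ^ 2).sum := by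
    rw [← sum_gramEigenvalues]
    exact Finset.sum_nonneg fun j _ => hn j
  rw [logDet_eq_sum l hμ]
  refine sum_le_of_ridgeParam_le hk l hμ hl (Real.log_nonneg ?_) (fun i => ?_) (fun i => ?_)
  · have := div_nonneg hT0 hμ.le
    linarith
  · refine Real.log_le_log (by linarith [hd i]) ?_
    have := div_le_div_of_nonneg_right (hT i) hμ.le
    linarith
  · have := Real.log_le_sub_one_of_pos (x := 1 + gramEigenvalues l i / μ) (by linarith [hd i])
    linarith

/-- `log (1 + s / μ)` is convex in `log μ`, and this is its tangent line at `μ`. Concretely it is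
Bernoulli's inequality for the exponent `s / (s + μ) ≤ 1`. -/
theorem log_one_add_div_le {s μ ν : ℝ} (hs : 0 ≤ s) (hμ : 0 < μ) (hμν : μ ≤ ν) :
    Real.log (1 + s / μ) ≤ Real.log (1 + s / ν) + s / (s + μ) * Real.log (ν / μ) := by
  have hν : 0 < ν := hμ.trans_le hμν
  have hsμ : 0 < s + μ := by linarith
  set p := s / (s + μ) with hp
  have hp0 : 0 ≤ p := div_nonneg hs hsμ.le
  have hp1 : p ≤ 1 := div_le_one_of_le₀ (by linarith) hsμ.le
  have h := rpow_one_add_le_one_add_mul_self (s := μ / ν - 1)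
    (by have := div_pos hμ hν; linarith) hp0 hp1
  have h1 : 1 + p * (μ / ν - 1) = (1 + s / ν) / (1 + s / μ) := by
    rw [hp]; field_simp; ring
  rw [h1, add_sub_cancel] at h
  have h2 := Real.log_le_log (Real.rpow_pos_of_pos (div_pos hμ hν) p) h
  rw [Real.log_rpow (div_pos hμ hν), Real.log_div hμ.ne' hν.ne',
    Real.log_div (by positivity) (by positivity)] at h2
  rw [Real.log_div hν.ne' hμ.ne']
  linarith

theorem logDet_le_logDet_add {d k : ℕ} (hk : 1 ≤ k) (l : List (EuclideanSpace ℝ (Fin d)))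
    {μ ν : ℝ} (hμ : 0 < μ) (hl : ridgeParam k (rowMatrix l) ≤ μ) (hμν : μ ≤ ν) :
    logDet l μ ≤ logDet l ν + 2 * k * Real.log (ν / μ) := by
  have hν : 0 < ν := hμ.trans_le hμν
  have hlog : 0 ≤ Real.log (ν / μ) := Real.log_nonneg ((one_le_div hμ).2 hμν)
  rw [logDet_eq_sum l hμ, logDet_eq_sum l hν]
  calc _ ≤ ∑ i, (Real.log (1 + gramEigenvalues l i / ν)
        + gramEigenvalues l i / (gramEigenvalues l i + μ) * Real.log (ν / μ)) :=
        Finset.sum_le_sum fun i _ => log_one_add_div_le (gramEigenvalues_nonneg l i) hμ hμν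
    _ ≤ _ := by
        rw [Finset.sum_add_distrib, ← Finset.sum_mul]
        have := mul_le_mul_of_nonneg_right (sum_div_add_le hk l hμ hl) hlog
        linarith

theorem ridgeScore_nonneg {d : ℕ} (l : List (EuclideanSpace ℝ (Fin d))) {μ : ℝ} (hμ : 0 < μ)
    (x : EuclideanSpace ℝ (Fin d)) : 0 ≤ ridgeScore (rowMatrix l) μ x := by
  rw [ridgeScore_eq l hμ]
  refine Finset.sum_nonneg fun i _ => div_nonneg (sq_nonneg _) ?_
  linarith [gramEigenvalues_nonneg l i]

theorem div_mul_ridgeScore_le {d : ℕ} (l : List (EuclideanSpace ℝ (Fin d))) {μ ν : ℝ} (hμ : 0 < μ)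
    (hμν : μ ≤ ν) (x : EuclideanSpace ℝ (Fin d)) :
    μ / ν * ridgeScore (rowMatrix l) μ x ≤ ridgeScore (rowMatrix l) ν x := by
  have hν : 0 < ν := hμ.trans_le hμν
  rw [ridgeScore_eq l hμ, ridgeScore_eq l hν, Finset.mul_sum]
  refine Finset.sum_le_sum fun i _ => ?_
  have hn := gramEigenvalues_nonneg l i
  rw [div_mul_div_comm]
  rw [div_le_div_iff₀ (by positivity) (by positivity)]
  have h1 : μ * (gramEigenvalues l i + ν) ≤ ν * (gramEigenvalues l i + μ) := by nlinarith
  nlinarith [mul_le_mul_of_nonneg_left h1 (sq_nonneg (inner ℝ (gramBasis l i) x))]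

/-- Appending a row of ridge leverage score at least `1 / 2` increases the potential
`logDet l lam + 3 k log lam`, where `lam` is the ridge parameter of `l`, by `log (3 / 2)`. -/
theorem logDet_step {d k : ℕ} (hk : 1 ≤ k) (l : List (EuclideanSpace ℝ (Fin d)))
    (x : EuclideanSpace ℝ (Fin d)) {μ ν : ℝ} (hμ : 0 < μ) (hl : ridgeParam k (rowMatrix l) ≤ μ)
    (hμν : μ ≤ ν) (hx : 1 / 2 ≤ ridgeScore (rowMatrix l) μ x) :
    logDet l μ + 3 * k * Real.log μ + Real.log (3 / 2)
      ≤ logDet (l ++ [x]) ν + 3 * k * Real.log ν := by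
  have hν : 0 < ν := hμ.trans_le hμν
  have hk' : (1 : ℝ) ≤ k := by exact_mod_cast hk
  have h1 := logDet_le_logDet_add hk l hμ hl hμν
  rw [logDet_concat l hν x (ridgeScore_nonneg l hν x)]
  have h2 := div_mul_ridgeScore_le l hμ hμν x
  have hr : 1 ≤ ν / μ := (one_le_div hμ).2 hμν
  have hlog : 0 ≤ Real.log (ν / μ) := Real.log_nonneg hr
  -- At `ν` the score may drop below `1 / 2`, but the factor `ν / μ` makes up for it. This uses one
  -- `log (ν / μ)`, paid by the third `k log`; the other two pay for `h1`.
  have h3 : Real.log (3 / 2) ≤ Real.log (1 + ridgeScore (rowMatrix l) ν x) + Real.log (ν / μ) := by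
    rw [← Real.log_mul (by linarith [ridgeScore_nonneg l hν x]) (by positivity)]
    refine Real.log_le_log (by norm_num) ?_
    have h4 : 1 / 2 ≤ ridgeScore (rowMatrix l) ν x * (ν / μ) := by
      calc 1 / 2 ≤ ridgeScore (rowMatrix l) μ x := hx
        _ = (μ / ν * ridgeScore (rowMatrix l) μ x) * (ν / μ) := by field_simp
        _ ≤ _ := by gcongr
    linarith
  have h5 : Real.log (ν / μ) ≤ k * Real.log (ν / μ) := by nlinarith
  have h6 : Real.log (ν / μ) = Real.log ν - Real.log μ := Real.log_div hν.ne' hμ.ne'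
  have h7 : (k : ℝ) * Real.log (ν / μ) = k * Real.log ν - k * Real.log μ := by rw [h6]; ring
  linarith

/-! ### The structure of a run of the algorithm -/

theorem run_concat {d : ℕ} (k : ℕ) (l : List (EuclideanSpace ℝ (Fin d)))
    (x : EuclideanSpace ℝ (Fin d)) : run k (l ++ [x]) = step k (run k l) x := by
  simp [run]

theorem run_concat_of_selects {d k : ℕ} {l : List (EuclideanSpace ℝ (Fin d))}
    {x : EuclideanSpace ℝ (Fin d)} (h : Selects k (run k l) x) :
    (run k (l ++ [x])).stored = (run k l).stored ++ [((run k l).clock, x)] := by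
  rw [run_concat, step]
  exact if_pos h

theorem run_concat_of_not_selects {d k : ℕ} {l : List (EuclideanSpace ℝ (Fin d))}
    {x : EuclideanSpace ℝ (Fin d)} (h : ¬ Selects k (run k l) x) :
    (run k (l ++ [x])).stored = (run k l).stored := by
  rw [run_concat, step]
  exact if_neg h

theorem run_clock {d : ℕ} (k : ℕ) (l : List (EuclideanSpace ℝ (Fin d))) :
    (run k l).clock = l.length := by
  induction l using List.reverseRecOn with
  | nil => rfl
  | append_singleton l x ih => rw [run_concat, List.length_append, ← ih]; rfl

theorem run_lam {d k : ℕ} (hk : 1 ≤ k) (l : List (EuclideanSpace ℝ (Fin d))) :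
    (run k l).lam = ridgeParam k (rowMatrix (run k l).rows) := by
  induction l using List.reverseRecOn with
  | nil =>
    have hk' : (0 : ℝ) < k := by exact_mod_cast hk
    have h := mul_ridgeParam_le_sum_norm_sq (d := d) hk []
    have h0 := ridgeParam_nonneg (d := d) hk []
    simp only [List.map_nil, List.sum_nil] at h
    exact le_antisymm h0 (nonpos_of_mul_nonpos_right h hk')
  | append_singleton l x ih => rw [run_concat]; rfl

theorem run_stored_prefix {d : ℕ} (k : ℕ) (l l' : List (EuclideanSpace ℝ (Fin d))) :
    (run k l).stored <+: (run k (l ++ l')).stored := by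
  induction l' using List.reverseRecOn with
  | nil => simp
  | append_singleton l' x ih =>
    refine ih.trans ?_
    rw [← List.append_assoc]
    by_cases h : Selects k (run k (l ++ l')) x
    · rw [run_concat_of_selects h]; exact List.prefix_append _ _
    · rw [run_concat_of_not_selects h]

theorem run_rows_prefix {d : ℕ} (k : ℕ) (l l' : List (EuclideanSpace ℝ (Fin d))) :
    (run k l).rows <+: (run k (l ++ l')).rows :=
  (run_stored_prefix k l l').map _

/-- Equal rows may occur several times in the stream, so stored rows are identified by their
positions. -/
theorem run_stored_getElem? {d : ℕ} (k : ℕ) (l : List (EuclideanSpace ℝ (Fin d))) :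
    ∀ p ∈ (run k l).stored, l[p.1]? = some p.2 := by
  induction l using List.reverseRecOn with
  | nil => simp [run, initState]
  | append_singleton l x ih =>
    have ih' : ∀ p ∈ (run k l).stored, (l ++ [x])[p.1]? = some p.2 := fun p hp => by
      have h := ih p hp
      rwa [List.getElem?_append_left (List.getElem?_eq_some_iff.1 h).1]
    by_cases h : Selects k (run k l) x
    · rw [run_concat_of_selects h]
      intro p hp
      rcases List.mem_append.1 hp with hp | hp
      · exact ih' p hp
      · rw [List.mem_singleton.1 hp]
        simp [run_clock]
    · rwa [run_concat_of_not_selects h]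

theorem run_stored_fst_lt {d : ℕ} (k : ℕ) (l : List (EuclideanSpace ℝ (Fin d))) :
    ∀ p ∈ (run k l).stored.map Prod.fst, p < l.length := by
  intro p hp
  obtain ⟨q, hq, rfl⟩ := List.mem_map.1 hp
  exact (List.getElem?_eq_some_iff.1 (run_stored_getElem? k l q hq)).1

theorem run_stored_nodup {d : ℕ} (k : ℕ) (l : List (EuclideanSpace ℝ (Fin d))) :
    ((run k l).stored.map Prod.fst).Nodup := by
  induction l using List.reverseRecOn with
  | nil => simp [run, initState]
  | append_singleton l x ih =>
    by_cases h : Selects k (run k l) x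
    · rw [run_concat_of_selects h, List.map_append, List.nodup_append]
      refine ⟨ih, by simp, ?_⟩
      intro p hp q hq
      have := run_stored_fst_lt k l p hp
      simp only [List.map_cons, List.map_nil, List.mem_singleton, run_clock] at hq
      omega
    · rwa [run_concat_of_not_selects h]

theorem mem_stored_of_selects {d k : ℕ} {l : List (EuclideanSpace ℝ (Fin d))}
    {x : EuclideanSpace ℝ (Fin d)} (l' : List (EuclideanSpace ℝ (Fin d)))
    (h : Selects k (run k l) x) : (l.length, x) ∈ (run k (l ++ [x] ++ l')).stored := by
  refine (run_stored_prefix k (l ++ [x]) l').subset ?_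
  rw [run_concat_of_selects h, run_clock]
  simp

/-- The vectors `c e_1, …, c e_m`. -/
noncomputable def scaledBasis (d m : ℕ) (c : ℝ) : List (EuclideanSpace ℝ (Fin d)) :=
  (List.range m).map fun j => c • stdVec d j

theorem scaledBasis_succ (d m : ℕ) (c : ℝ) :
    scaledBasis d (m + 1) c = scaledBasis d m c ++ [c • stdVec d m] := by
  simp [scaledBasis, List.range_succ]

theorem length_scaledBasis (d m : ℕ) (c : ℝ) : (scaledBasis d m c).length = m := by
  simp [scaledBasis]

theorem smul_stdVec_notMem_span {d m : ℕ} (hm : m < d) {c : ℝ} (hc : c ≠ 0) :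
    c • stdVec d m ∉ Submodule.span ℝ {y | y ∈ scaledBasis d m c} := by
  intro h
  have hle : Submodule.span ℝ {y | y ∈ scaledBasis d m c}
      ≤ LinearMap.ker (EuclideanSpace.proj (𝕜 := ℝ) (⟨m, hm⟩ : Fin d)).toLinearMap := by
    rw [Submodule.span_le]
    intro y hy
    obtain ⟨j, hj, rfl⟩ := List.mem_map.1 hy
    have : m ≠ j := (List.mem_range.1 hj).ne'
    simp [stdVec, this]
  have := hle h
  simp [stdVec, hc] at this

theorem finrank_span_scaledBasis_le (d m : ℕ) (c : ℝ) :
    Module.finrank ℝ (Submodule.span ℝ {y | y ∈ scaledBasis d m c}) ≤ m := by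
  classical
  have h : {y | y ∈ scaledBasis d m c} = ((scaledBasis d m c).toFinset : Set _) := by
    ext; simp
  rw [h]
  refine (finrank_span_finset_le_card _).trans ?_
  exact (List.toFinset_card_le _).trans (length_scaledBasis d m c).le

/-- Before each of these vectors is read at most `k` are stored, so they span dimension at most `k`,
the ridge parameter is `0`, and the row-space rule selects the new independent vector. This works up
to the `(k + 1)`-st vector. -/
theorem run_scaledBasis_rows {d k : ℕ} (hk : 1 ≤ k) {c : ℝ} (hc : c ≠ 0) {m : ℕ}
    (hmk : m ≤ k + 1) (hmd : m ≤ d) :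
    (run k (scaledBasis d m c)).rows = scaledBasis d m c := by
  have hk' : (0 : ℝ) < k := by exact_mod_cast hk
  induction m with
  | zero => rfl
  | succ m ih =>
    have ih := ih (by omega) (by omega)
    have hsel : Selects k (run k (scaledBasis d m c)) (c • stdVec d m) := by
      refine Or.inl ⟨?_, ?_⟩
      · rw [run_lam hk, ih]
        refine le_antisymm ?_ (ridgeParam_nonneg hk _)
        have h := mul_ridgeParam_le_residualCost hk (scaledBasis d m c) _
          ((finrank_span_scaledBasis_le d m c).trans (by omega))
        refine nonpos_of_mul_nonpos_right (h.trans (le_of_eq ?_)) hk'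
        refine List.sum_eq_zero fun r hr => ?_
        obtain ⟨y, hy, rfl⟩ := List.mem_map.1 hr
        have : y ∈ Submodule.span ℝ {y | y ∈ scaledBasis d m c} := Submodule.subset_span hy
        simp [Metric.infDist_zero_of_mem this]
      · rw [ih]
        exact smul_stdVec_notMem_span (by omega) hc
    rw [CoresetState.rows, scaledBasis_succ, run_concat_of_selects hsel, List.map_append]
    rw [CoresetState.rows] at ih
    rw [ih]
    rfl

theorem orthonormal_stdVec {d m : ℕ} (hm : m ≤ d) :
    Orthonormal ℝ fun j : Fin m => stdVec d j := by
  have h := (EuclideanSpace.orthonormal_single (𝕜 := ℝ) (ι := Fin d)).comp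
    (Fin.castLE hm) (Fin.castLE_injective hm)
  convert h using 1
  funext j
  ext i
  simp [stdVec, Fin.ext_iff]

theorem norm_stdVec {d j : ℕ} (hj : j < d) : ‖stdVec d j‖ = 1 :=
  (orthonormal_stdVec (Nat.succ_le_of_lt hj)).1 ⟨j, Nat.lt_succ_self j⟩

/-- Of the total squared length `(k + 1) c ^ 2`, a subspace of dimension at most `k` captures at
most `k c ^ 2`. -/
theorem sq_le_mul_ridgeParam_scaledBasis {d k : ℕ} (hk : 1 ≤ k) (hkd : k < d) (c : ℝ) :
    c ^ 2 ≤ k * ridgeParam k (rowMatrix (scaledBasis d (k + 1) c)) := by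
  refine le_mul_ridgeParam hk _ _ fun W hW => ?_
  have h := sum_norm_starProjection_sq_le (orthonormal_stdVec (Nat.succ_le_of_lt hkd)) W
  have hWk : (Module.finrank ℝ W : ℝ) ≤ k := by exact_mod_cast hW
  have hres : residualCost (scaledBasis d (k + 1) c) W
      = ∑ j : Fin (k + 1), c ^ 2 * (1 - ‖W.starProjection (stdVec d j)‖ ^ 2) := by
    rw [residualCost, scaledBasis, List.map_map, ← List.sum_toFinset _ (List.nodup_range),
      List.toFinset_range, Finset.sum_range]
    refine Finset.sum_congr rfl fun j _ => ?_
    rw [Function.comp_apply, infDist_sq_eq, map_smul, norm_smul, norm_smul,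
      norm_stdVec (by omega), mul_one, mul_pow, Real.norm_eq_abs, sq_abs]
    ring
  rw [hres, ← Finset.mul_sum, Finset.sum_sub_distrib]
  simp only [Finset.sum_const, Finset.card_univ, Fintype.card_fin, nsmul_eq_mul, mul_one,
    Nat.cast_add, Nat.cast_one]
  nlinarith [sq_nonneg c]

/-- After the vectors `c e_1, …, c e_{k+1}` the ridge parameter stays at least `c ^ 2 / k`, and every
further selected row increases the potential by `log (3 / 2)`. -/
theorem potential_run {d k : ℕ} (hk : 1 ≤ k) (hkd : k < d) {c : ℝ} (hc : 0 < c)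
    (l : List (EuclideanSpace ℝ (Fin d))) :
    c ^ 2 / k ≤ (run k (scaledBasis d (k + 1) c ++ l)).lam ∧
    3 * k * Real.log (c ^ 2 / k)
        + (((run k (scaledBasis d (k + 1) c ++ l)).stored.length : ℝ) - (k + 1)) * Real.log (3 / 2)
      ≤ logDet (run k (scaledBasis d (k + 1) c ++ l)).rows
          (run k (scaledBasis d (k + 1) c ++ l)).lam
        + 3 * k * Real.log (run k (scaledBasis d (k + 1) c ++ l)).lam := by
  have hk' : (0 : ℝ) < k := by exact_mod_cast hk
  have hc2 : 0 < c ^ 2 / k := by positivity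
  induction l using List.reverseRecOn with
  | nil =>
    have hrows := run_scaledBasis_rows (d := d) hk hc.ne' (m := k + 1) le_rfl (by omega)
    have hlen : (run k (scaledBasis d (k + 1) c)).stored.length = k + 1 := by
      have := congrArg List.length hrows
      rwa [CoresetState.rows, List.length_map, length_scaledBasis] at this
    have hlam : c ^ 2 / k ≤ (run k (scaledBasis d (k + 1) c)).lam := by
      rw [run_lam hk, hrows, div_le_iff₀' hk']
      exact sq_le_mul_ridgeParam_scaledBasis hk hkd c
    rw [List.append_nil]
    refine ⟨hlam, ?_⟩
    rw [hlen]
    push_cast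
    rw [sub_self, zero_mul, add_zero]
    have h1 := logDet_nonneg (run k (scaledBasis d (k + 1) c)).rows (hc2.trans_le hlam)
    have h2 := mul_le_mul_of_nonneg_left (Real.log_le_log hc2 hlam)
      (by positivity : (0 : ℝ) ≤ 3 * k)
    linarith
  | append_singleton l x ih =>
    rw [← List.append_assoc]
    set l₀ := scaledBasis d (k + 1) c ++ l
    obtain ⟨ih1, ih2⟩ := ih
    have hpos := hc2.trans_le ih1
    by_cases h : Selects k (run k l₀) x
    · have hst := run_concat_of_selects h
      have hrows : (run k (l₀ ++ [x])).rows = (run k l₀).rows ++ [x] := by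
        simp [CoresetState.rows, hst]
      have hle : (run k l₀).lam ≤ (run k (l₀ ++ [x])).lam := by
        rw [run_lam hk, run_lam hk, hrows]
        exact ridgeParam_le_append hk _ _
      -- A positive `lam` rules out the row-space rule, and `1 / (1 + 1 / k) ≥ 1 / 2` since `k ≥ 1`.
      have hscore : 1 / 2 ≤ ridgeScore (rowMatrix (run k l₀).rows) (run k l₀).lam x := by
        rcases h with h | h
        · exact absurd h.1 hpos.ne'
        · refine le_trans ?_ h
          have : 1 / (k : ℝ) ≤ 1 := by
            rw [div_le_one hk']; exact_mod_cast hk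
          exact one_div_le_one_div_of_le (by positivity) (by linarith)
      have hstep := logDet_step hk (run k l₀).rows x hpos (run_lam hk l₀).ge hle hscore
      refine ⟨ih1.trans hle, ?_⟩
      rw [hrows, hst, List.length_append, List.length_singleton]
      push_cast
      linarith
    · have hst := run_concat_of_not_selects h
      have hrows : (run k (l₀ ++ [x])).rows = (run k l₀).rows := by
        simp [CoresetState.rows, hst]
      have hlam : (run k (l₀ ++ [x])).lam = (run k l₀).lam := by
        rw [run_lam hk, run_lam hk, hrows]
      rw [hst, hrows, hlam]
      exact ⟨ih1, ih2⟩

/-! ### The coreset -/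

theorem prefixedStream_eq {d n : ℕ} (k : ℕ) (c : ℝ) (a : Fin n → EuclideanSpace ℝ (Fin d)) :
    prefixedStream k c a = scaledBasis d (k + 1) c ++ List.ofFn a := rfl

theorem prefixedStream_getElem?_add {d n : ℕ} (k : ℕ) (c : ℝ)
    (a : Fin n → EuclideanSpace ℝ (Fin d)) (i : Fin n) :
    (prefixedStream k c a)[k + 1 + (i : ℕ)]? = some (a i) := by
  rw [prefixedStream_eq, List.getElem?_append_right (by rw [length_scaledBasis]; omega),
    length_scaledBasis]
  simp

theorem prefixedStream_getElem?_lt {d n : ℕ} (k : ℕ) (c : ℝ)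
    (a : Fin n → EuclideanSpace ℝ (Fin d)) {j : ℕ} (hj : j < k + 1) :
    (prefixedStream k c a)[j]? = some (c • stdVec d j) := by
  rw [prefixedStream_eq, List.getElem?_append_left (by rwa [length_scaledBasis])]
  simp [scaledBasis, hj]

theorem prefixedStream_split {d n : ℕ} (k : ℕ) (c : ℝ)
    (a : Fin n → EuclideanSpace ℝ (Fin d)) (i : Fin n) :
    ∃ l l', prefixedStream k c a = scaledBasis d (k + 1) c ++ l ++ [a i] ++ l' ∧
      l.length = i := by
  refine ⟨(List.ofFn a).take i, (List.ofFn a).drop (i + 1), ?_, by simp⟩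
  have h : (List.ofFn a).drop i = a i :: (List.ofFn a).drop (i + 1) := by
    rw [List.drop_eq_getElem_cons (by simp)]
    simp
  rw [prefixedStream_eq, List.append_assoc, List.append_assoc, List.singleton_append, ← h,
    List.take_append_drop]

theorem toFinset_positions {d n k : ℕ} (hk : 1 ≤ k) (hkd : k < d) {c : ℝ} (hc : c ≠ 0)
    (a : Fin n → EuclideanSpace ℝ (Fin d)) :
    ((run k (prefixedStream k c a)).stored.map Prod.fst).toFinset
      = Finset.range (k + 1) ∪ (coreset k c a).image fun i : Fin n => k + 1 + (i : ℕ) := by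
  ext p
  rw [List.mem_toFinset, Finset.mem_union, Finset.mem_range, Finset.mem_image]
  constructor
  · intro hp
    have hlt := run_stored_fst_lt k _ p hp
    rw [prefixedStream_eq, List.length_append, length_scaledBasis, List.length_ofFn] at hlt
    by_cases hpk : p < k + 1
    · exact Or.inl hpk
    · refine Or.inr ⟨⟨p - (k + 1), by omega⟩, ?_, by simp only; omega⟩
      have : k + 1 + (p - (k + 1)) = p := by omega
      simpa [coreset, this] using hp
  · rintro (hp | ⟨i, hi, rfl⟩)
    · have hrows := run_scaledBasis_rows (d := d) hk hc (m := k + 1) le_rfl (by omega)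
      have hlen : ((run k (scaledBasis d (k + 1) c)).stored.map Prod.fst).length = k + 1 := by
        have := congrArg List.length hrows
        rwa [CoresetState.rows, List.length_map, length_scaledBasis, ← List.length_map Prod.fst]
          at this
      have hsub : ((run k (scaledBasis d (k + 1) c)).stored.map Prod.fst).toFinset
          ⊆ Finset.range (k + 1) := by
        intro q hq
        have := run_stored_fst_lt k _ q (List.mem_toFinset.1 hq)
        rwa [length_scaledBasis, ← Finset.mem_range] at this
      -- There are `k + 1` distinct positions below `k + 1`, hence all of them occur.
      have heq := Finset.eq_of_subset_of_card_le hsub (by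
        rw [List.toFinset_card_of_nodup (run_stored_nodup k _), hlen, Finset.card_range])
      have hp' : p ∈ (run k (scaledBasis d (k + 1) c)).stored.map Prod.fst := by
        rw [← List.mem_toFinset, heq, Finset.mem_range]
        exact hp
      exact ((run_stored_prefix k (scaledBasis d (k + 1) c) (List.ofFn a)).map _).subset hp'
    · exact (Finset.mem_filter.1 hi).2

/-- Passes from the list of stored rows to the index set `S`; used for counting, for squared norms
and for squared distances. -/
theorem sum_map_rows {d n k : ℕ} (hk : 1 ≤ k) (hkd : k < d) {c : ℝ} (hc : c ≠ 0)
    (a : Fin n → EuclideanSpace ℝ (Fin d)) (f : EuclideanSpace ℝ (Fin d) → ℝ) :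
    ((run k (prefixedStream k c a)).rows.map f).sum
      = ∑ j ∈ Finset.range (k + 1), f (c • stdVec d j) + ∑ i ∈ coreset k c a, f (a i) := by
  set st := (run k (prefixedStream k c a)).stored with hst
  -- The default `0` is never reached at a stored position.
  let h : ℕ → ℝ := fun p => f ((prefixedStream k c a)[p]?.getD 0)
  have h1 : (run k (prefixedStream k c a)).rows.map f = (st.map Prod.fst).map h := by
    rw [CoresetState.rows, List.map_map, List.map_map]
    refine List.map_congr_left fun p hp => ?_
    simp [h, run_stored_getElem? k _ p hp]
  rw [h1, ← List.sum_toFinset _ (run_stored_nodup k _), toFinset_positions hk hkd hc,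
    Finset.sum_union, Finset.sum_image]
  · congr 1
    · refine Finset.sum_congr rfl fun j hj => ?_
      rw [prefixedStream_getElem?_lt k c a (Finset.mem_range.1 hj), Option.getD_some]
    · refine Finset.sum_congr rfl fun i _ => ?_
      rw [prefixedStream_getElem?_add, Option.getD_some]
  · intro i _ j _ hij
    exact Fin.ext (by simpa using hij)
  · rw [Finset.disjoint_left]
    intro p hp hp'
    obtain ⟨i, _, rfl⟩ := Finset.mem_image.1 hp'
    have := Finset.mem_range.1 hp
    omega

theorem length_stored {d n k : ℕ} (hk : 1 ≤ k) (hkd : k < d) {c : ℝ} (hc : c ≠ 0)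
    (a : Fin n → EuclideanSpace ℝ (Fin d)) :
    (run k (prefixedStream k c a)).stored.length = k + 1 + (coreset k c a).card := by
  have h := sum_map_rows hk hkd hc a fun _ => 1
  simp only [List.map_const', List.sum_replicate, Finset.sum_const, Finset.card_range,
    nsmul_eq_mul, mul_one, CoresetState.rows, List.length_map] at h
  exact_mod_cast h

/-! ### The size of the coreset -/

theorem sum_norm_sq_smul_stdVec {d k : ℕ} (hkd : k < d) (c : ℝ) :
    ∑ j ∈ Finset.range (k + 1), ‖c • stdVec d j‖ ^ 2 = (k + 1) * c ^ 2 := by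
  rw [Finset.sum_congr rfl fun j hj => show ‖c • stdVec d j‖ ^ 2 = c ^ 2 by
    have := Finset.mem_range.1 hj
    rw [norm_smul, norm_stdVec (by omega), mul_one, Real.norm_eq_abs, sq_abs]]
  simp

/-- Compares the two bounds on the final potential: `potential_run` from below, `logDet_le` from
above. Since `lam ≤ T`, the remaining occurrences of `lam` are replaced by `2 * T`. -/
theorem card_mul_log_le {d n k : ℕ} (hk : 1 ≤ k) (hkd : k < d) {c : ℝ} (hc : 0 < c)
    (a : Fin n → EuclideanSpace ℝ (Fin d)) {T : ℝ}
    (hT : (k + 1) * c ^ 2 + ∑ i ∈ coreset k c a, ‖a i‖ ^ 2 ≤ T) :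
    (coreset k c a).card * Real.log (3 / 2)
      ≤ k + 3 * k * Real.log (2 * T / (c ^ 2 / k)) := by
  have hk1 : (1 : ℝ) ≤ k := by exact_mod_cast hk
  have hk' : (0 : ℝ) < k := by linarith
  have h0 : 0 < c ^ 2 / k := by positivity
  obtain ⟨h1, h2⟩ := potential_run hk hkd hc (List.ofFn a)
  rw [← prefixedStream_eq] at h1 h2
  have hlam := run_lam hk (prefixedStream k c a)
  have hlen := length_stored hk hkd hc.ne' a
  have hsum := sum_map_rows hk hkd hc.ne' a fun y => ‖y‖ ^ 2
  rw [sum_norm_sq_smul_stdVec hkd] at hsum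
  set s := run k (prefixedStream k c a)
  have hpos := h0.trans_le h1
  have h3 := logDet_le hk s.rows hpos hlam.ge
  have h4 := mul_ridgeParam_le_sum_norm_sq hk s.rows
  rw [← hlam] at h4
  rw [hsum] at h3 h4
  have h5 : s.lam ≤ T := by nlinarith
  have hTpos : 0 < T := hpos.trans_le h5
  have h6 : Real.log (1 + ((k + 1) * c ^ 2 + ∑ i ∈ coreset k c a, ‖a i‖ ^ 2) / s.lam)
      ≤ Real.log (2 * T) - Real.log s.lam := by
    rw [← Real.log_div (by positivity) hpos.ne']
    refine Real.log_le_log ?_ ?_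
    · have : 0 ≤ ∑ i ∈ coreset k c a, ‖a i‖ ^ 2 := Finset.sum_nonneg fun i _ => sq_nonneg _
      positivity
    · rw [le_div_iff₀ hpos, add_mul, div_mul_cancel₀ _ hpos.ne']
      linarith
  have h7 : Real.log s.lam ≤ Real.log (2 * T) := Real.log_le_log hpos (by linarith)
  rw [Real.log_div (by positivity) h0.ne']
  rw [hlen] at h2
  push_cast at h2
  have h8 := mul_le_mul_of_nonneg_left h6 hk'.le
  have h9 := mul_le_mul_of_nonneg_left h7 hk'.le
  linarith

theorem card_coreset_le {d n k : ℕ} (hk : 1 ≤ k) (hkd : k < d)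
    (a : Fin n → EuclideanSpace ℝ (Fin d)) {R δ : ℝ} (hδ : 0 < δ) (hδR : δ < R)
    (ha : ∀ i, ‖a i‖ < R) :
    ((coreset k (δ / (2 * √((k : ℝ) + 1))) a).card : ℝ)
      ≤ 192 * k * max 1 (Real.log (k * R / δ)) := by
  set c := δ / (2 * √((k : ℝ) + 1)) with hc_def
  set S := coreset k c a with hS
  set Lg := max 1 (Real.log (k * R / δ))
  have hk1 : (1 : ℝ) ≤ k := by exact_mod_cast hk
  have hk' : (0 : ℝ) < k := by linarith
  have hR : 0 < R := hδ.trans hδR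
  have hc : 0 < c := by positivity
  have hc2 : (k + 1) * c ^ 2 = δ ^ 2 / 4 := by
    rw [hc_def, div_pow, mul_pow, Real.sq_sqrt (by positivity)]
    field_simp
    ring
  have hL1 : 1 ≤ Lg := le_max_left _ _
  rcases Nat.eq_zero_or_pos S.card with h0 | h0
  · rw [h0]; push_cast; positivity
  have hN : (1 : ℝ) ≤ S.card := by exact_mod_cast h0
  set N : ℝ := (S.card : ℝ)
  set X := k * R / δ with hX
  have hkX : (k : ℝ) ≤ X := by
    rw [hX, le_div_iff₀ hδ]
    exact mul_le_mul_of_nonneg_left hδR.le hk'.le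
  have hXpos : 0 < X := hk'.trans_le hkX
  have hsum : ∑ i ∈ S, ‖a i‖ ^ 2 ≤ N * R ^ 2 := by
    rw [← nsmul_eq_mul]
    exact Finset.sum_le_card_nsmul _ _ _ fun i _ =>
      pow_le_pow_left₀ (norm_nonneg _) (ha i).le 2
  have hT : (k + 1) * c ^ 2 + ∑ i ∈ S, ‖a i‖ ^ 2 ≤ 2 * N * R ^ 2 := by
    have h1 : δ ^ 2 ≤ R ^ 2 := pow_le_pow_left₀ hδ.le hδR.le 2
    have h2 : R ^ 2 ≤ N * R ^ 2 := le_mul_of_one_le_left (by positivity) hN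
    rw [hc2]
    nlinarith [sq_nonneg δ]
  have hmain := card_mul_log_le hk hkd hc a hT
  have hfrac : 2 * (2 * N * R ^ 2) / (c ^ 2 / k) ≤ 2 ^ 5 * N * X ^ 2 := by
    have hc3 : c ^ 2 = δ ^ 2 / (4 * (k + 1)) := by
      rw [eq_div_iff (by positivity)]; linarith
    have h1 : 2 * (2 * N * R ^ 2) / (c ^ 2 / k) = 16 * N * (k * (k + 1)) * (R ^ 2 / δ ^ 2) := by
      rw [hc3]; field_simp; ring
    have h2 : 2 ^ 5 * N * X ^ 2 = 16 * N * (2 * k ^ 2) * (R ^ 2 / δ ^ 2) := by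
      rw [hX]; field_simp; ring
    have h3 : (k : ℝ) * (k + 1) ≤ 2 * k ^ 2 := by nlinarith
    rw [h1, h2]
    exact mul_le_mul_of_nonneg_right (mul_le_mul_of_nonneg_left h3 (by positivity)) (by positivity)
  have hlogX : Real.log X ≤ Lg := le_max_right _ _
  have hlogk : Real.log k ≤ Lg := (Real.log_le_log hk' hkX).trans hlogX
  have hlog2 := Real.log_two_lt_d9
  -- `N` also stands inside the logarithm on the right. Using `log y ≤ y - 1` at `y = N / (16 k)`
  -- returns `3 N / 16` after multiplication by `3 k`, less than the `N / 3` on the left.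
  have hlogN : Real.log N ≤ N / k / 16 + 2 + Lg := by
    have h1 : 0 < N / k / 16 := by positivity
    have h2 : Real.log N = Real.log (N / k / 16) + (4 * Real.log 2 + Real.log k) := by
      rw [show 4 * Real.log 2 = Real.log (2 ^ 4) by rw [Real.log_pow]; norm_num,
        ← Real.log_mul (by norm_num) hk'.ne', ← Real.log_mul h1.ne' (by positivity)]
      congr 1
      field_simp
      norm_num
    have h3 := Real.log_le_sub_one_of_pos h1
    linarith
  have hlogfrac : Real.log (2 * (2 * N * R ^ 2) / (c ^ 2 / k)) ≤ 6 + N / k / 16 + 3 * Lg := by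
    refine (Real.log_le_log (by positivity) hfrac).trans ?_
    rw [Real.log_mul (by positivity) (by positivity), Real.log_mul (by positivity) (by positivity),
      Real.log_pow, Real.log_pow]
    push_cast
    linarith
  have hlog32 : 1 / 3 ≤ Real.log (3 / 2) := by
    have := Real.one_sub_inv_le_log_of_pos (x := 3 / 2) (by norm_num)
    norm_num at this ⊢
    linarith
  have h1 : N * (1 / 3) ≤ k + 3 * k * (6 + N / k / 16 + 3 * Lg) :=
    (mul_le_mul_of_nonneg_left hlog32 (by positivity)).trans (hmain.trans (by gcongr))
  have h2 : k * (N / k / 16) = N / 16 := by field_simp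
  have h3 : (k : ℝ) ≤ k * Lg := le_mul_of_one_le_right hk'.le hL1
  -- `(1 / 3 - 3 / 16) N = 7 N / 48 ≤ 28 k Lg`, whence the constant `192`.
  nlinarith

/-! ### The quality of the coreset -/

/-- Test `inner_sq_le_ridgeScore_mul` on `w = x - P_V x`. As `w` is orthogonal to `V`, `⟨x, w⟩ = ‖w‖
^ 2`, and each row `y` satisfies `|⟨y, w⟩| ≤ d(y, V) ‖w‖`; then divide by `‖w‖ ^ 2`. -/
theorem sq_infDist_le_of_ridgeScore_le_one {d : ℕ} (l : List (EuclideanSpace ℝ (Fin d))) {μ : ℝ}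
    (hμ : 0 < μ) (x : EuclideanSpace ℝ (Fin d)) (hx : ridgeScore (rowMatrix l) μ x ≤ 1)
    (V : Submodule ℝ (EuclideanSpace ℝ (Fin d))) :
    Metric.infDist x (V : Set (EuclideanSpace ℝ (Fin d))) ^ 2 ≤ residualCost l V + μ := by
  set w := x - V.starProjection x with hw
  have horth : ∀ y : EuclideanSpace ℝ (Fin d), inner ℝ y w = inner ℝ (y - V.starProjection y) w := by
    intro y
    rw [inner_sub_left, real_inner_comm w (V.starProjection y),
      V.starProjection_inner_eq_zero x _ (V.starProjection_apply_mem y), sub_zero]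
  have hxw : inner ℝ x w = ‖w‖ ^ 2 := by
    rw [horth, ← hw, real_inner_self_eq_norm_sq]
  have hsum : (l.map fun y => (inner ℝ y w) ^ 2).sum ≤ residualCost l V * ‖w‖ ^ 2 := by
    rw [residualCost, ← List.sum_map_mul_right]
    refine List.sum_le_sum fun y _ => ?_
    rw [horth, infDist_eq_norm_sub_starProjection, ← mul_pow, ← sq_abs]
    exact pow_le_pow_left₀ (abs_nonneg _) (abs_real_inner_le_norm _ _) 2
  have h := inner_sq_le_ridgeScore_mul l hμ x w
  rw [hxw] at h
  rw [infDist_eq_norm_sub_starProjection, ← hw]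
  have hres := residualCost_nonneg l V
  rcases (sq_nonneg ‖w‖).eq_or_lt with h0 | h0
  · rw [← h0]; positivity
  · have hnn : 0 ≤ (l.map fun y => (inner ℝ y w) ^ 2).sum + μ * ‖w‖ ^ 2 := by
      refine add_nonneg (List.sum_nonneg ?_) (by positivity)
      simp only [List.mem_map, forall_exists_index, and_imp, forall_apply_eq_imp_iff₂]
      intro y _
      positivity
    have h1 := h.trans (mul_le_of_le_one_left hnn hx)
    refine le_of_mul_le_mul_right ?_ h0
    nlinarith

theorem infDist_le_maxDist {d n : ℕ} (a : Fin n → EuclideanSpace ℝ (Fin d)) (T : Finset (Fin n))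
    (V : Submodule ℝ (EuclideanSpace ℝ (Fin d))) {i : Fin n} (hi : i ∈ T) :
    Metric.infDist (a i) (V : Set (EuclideanSpace ℝ (Fin d))) ≤ maxDist a T V :=
  le_ciSup (f := fun i : T => Metric.infDist (a i) (V : Set (EuclideanSpace ℝ (Fin d))))
    (Set.finite_range _).bddAbove ⟨i, hi⟩

theorem maxDist_nonneg {d n : ℕ} (a : Fin n → EuclideanSpace ℝ (Fin d)) (T : Finset (Fin n))
    (V : Submodule ℝ (EuclideanSpace ℝ (Fin d))) : 0 ≤ maxDist a T V :=
  Real.iSup_nonneg fun _ => Metric.infDist_nonneg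

theorem optCost_le_maxDist {d n k : ℕ} (a : Fin n → EuclideanSpace ℝ (Fin d))
    (V : Submodule ℝ (EuclideanSpace ℝ (Fin d))) (hV : Module.finrank ℝ V = k) :
    optCost k a ≤ maxDist a Finset.univ V :=
  ciInf_le (f := fun V : {V : Submodule ℝ (EuclideanSpace ℝ (Fin d)) // Module.finrank ℝ V = k} =>
    maxDist a Finset.univ V.1)
    ⟨0, by rintro _ ⟨W, rfl⟩; exact maxDist_nonneg a _ W.1⟩ ⟨V, hV⟩

theorem residualCost_smul_stdVec_le {d k : ℕ} (hkd : k < d) (c : ℝ)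
    (V : Submodule ℝ (EuclideanSpace ℝ (Fin d))) :
    ∑ j ∈ Finset.range (k + 1),
        Metric.infDist (c • stdVec d j) (V : Set (EuclideanSpace ℝ (Fin d))) ^ 2
      ≤ (k + 1) * c ^ 2 := by
  rw [← sum_norm_sq_smul_stdVec hkd]
  refine Finset.sum_le_sum fun j _ => ?_
  rw [infDist_sq_eq]
  linarith [sq_nonneg ‖V.starProjection (c • stdVec d j)‖]

/-- When `a i` was discarded its score was at most `1` and `lam ≤ k * lam` was at most the residual
of `V`, which explains the factor `2`. The rows stored then remain stored, so the final residual
dominates. -/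
theorem sq_infDist_le_of_notMem_coreset {d n k : ℕ} (hk : 1 ≤ k) (hkd : k < d) {c : ℝ} (hc : 0 < c)
    (a : Fin n → EuclideanSpace ℝ (Fin d)) (V : Submodule ℝ (EuclideanSpace ℝ (Fin d)))
    (hV : Module.finrank ℝ V = k) {i : Fin n} (hi : i ∉ coreset k c a) :
    Metric.infDist (a i) (V : Set (EuclideanSpace ℝ (Fin d))) ^ 2
      ≤ 2 * ((k + 1) * c ^ 2 + (coreset k c a).card * maxDist a (coreset k c a) V ^ 2) := by
  have hk1 : (1 : ℝ) ≤ k := by exact_mod_cast hk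
  obtain ⟨l, l', hl, hlen⟩ := prefixedStream_split k c a i
  set l₀ := scaledBasis d (k + 1) c ++ l with hl₀
  have hlen₀ : l₀.length = k + 1 + i := by
    rw [hl₀, List.length_append, length_scaledBasis, hlen]
  have hsel : ¬ Selects k (run k l₀) (a i) := by
    intro h
    refine hi (Finset.mem_filter.2 ⟨Finset.mem_univ _, ?_⟩)
    rw [hl, ← hlen₀]
    exact List.mem_map_of_mem (f := Prod.fst) (mem_stored_of_selects l' h)
  have hpos : 0 < (run k l₀).lam :=
    lt_of_lt_of_le (by positivity) (potential_run hk hkd hc l).1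
  have hscore : ridgeScore (rowMatrix (run k l₀).rows) (run k l₀).lam (a i) ≤ 1 := by
    by_contra! h
    refine hsel (Or.inr (le_trans ?_ h.le))
    rw [div_le_one (by positivity)]
    linarith [show (0 : ℝ) ≤ 1 / k by positivity]
  have h1 := sq_infDist_le_of_ridgeScore_le_one _ hpos _ hscore V
  have h2 := mul_ridgeParam_le_residualCost hk (run k l₀).rows V hV.le
  rw [← run_lam hk] at h2
  have h3 : (run k l₀).lam ≤ residualCost (run k l₀).rows V :=
    (le_mul_of_one_le_left hpos.le hk1).trans h2
  have h4 : residualCost (run k l₀).rows V ≤ residualCost (run k (prefixedStream k c a)).rows V := by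
    obtain ⟨r, hr⟩ := run_rows_prefix k l₀ ([a i] ++ l')
    rw [hl, List.append_assoc, ← hr, residualCost_append]
    linarith [residualCost_nonneg r V]
  have h5 := sum_map_rows hk hkd hc.ne' a fun y =>
    Metric.infDist y (V : Set (EuclideanSpace ℝ (Fin d))) ^ 2
  have h6 := residualCost_smul_stdVec_le hkd c V
  have h7 : ∑ i ∈ coreset k c a, Metric.infDist (a i) (V : Set (EuclideanSpace ℝ (Fin d))) ^ 2
      ≤ (coreset k c a).card * maxDist a (coreset k c a) V ^ 2 := by
    rw [← nsmul_eq_mul]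
    exact Finset.sum_le_card_nsmul _ _ _ fun j hj =>
      pow_le_pow_left₀ Metric.infDist_nonneg (infDist_le_maxDist a _ V hj) 2
  rw [residualCost, residualCost, h5] at h4
  rw [residualCost] at h1 h3
  linarith

/-- The choice of `c` leaves an additive error of only `δ ^ 2 / 2`. Since `δ` is below the cost of
every `V`, this is at most half the squared cost and moves to the left side. -/
theorem maxDist_le_two_mul_sqrt_card_mul {d n k : ℕ} (hk : 1 ≤ k) (hkd : k < d)
    (a : Fin n → EuclideanSpace ℝ (Fin d)) {δ : ℝ} (hδ : 0 < δ) (hopt : δ < optCost k a)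
    (V : Submodule ℝ (EuclideanSpace ℝ (Fin d))) (hV : Module.finrank ℝ V = k) :
    maxDist a Finset.univ V
      ≤ 2 * √((coreset k (δ / (2 * √((k : ℝ) + 1))) a).card)
        * maxDist a (coreset k (δ / (2 * √((k : ℝ) + 1))) a) V := by
  set c := δ / (2 * √((k : ℝ) + 1)) with hc_def
  have hc : 0 < c := by positivity
  have hc2 : (k + 1) * c ^ 2 = δ ^ 2 / 4 := by
    rw [hc_def, div_pow, mul_pow, Real.sq_sqrt (by positivity)]
    field_simp
    ring
  set S := coreset k c a
  have hs := maxDist_nonneg a S V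
  have hδm := hopt.trans_le (optCost_le_maxDist a V hV)
  have hbound : ∀ i, Metric.infDist (a i) (V : Set (EuclideanSpace ℝ (Fin d))) ^ 2
      ≤ δ ^ 2 / 2 + 2 * S.card * maxDist a S V ^ 2 := by
    intro i
    by_cases hi : i ∈ S
    · have h1 := pow_le_pow_left₀ Metric.infDist_nonneg (infDist_le_maxDist a S V hi) 2
      have h2 : (1 : ℝ) ≤ S.card := by exact_mod_cast Finset.card_pos.2 ⟨i, hi⟩
      nlinarith [sq_nonneg δ, sq_nonneg (maxDist a S V)]
    · have := sq_infDist_le_of_notMem_coreset hk hkd hc a V hV hi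
      rw [hc2] at this
      linarith
  have hm : maxDist a Finset.univ V ≤ √(δ ^ 2 / 2 + 2 * S.card * maxDist a S V ^ 2) :=
    Real.iSup_le (fun i => Real.le_sqrt_of_sq_le (hbound i)) (Real.sqrt_nonneg _)
  have hm2 : maxDist a Finset.univ V ^ 2 ≤ δ ^ 2 / 2 + 2 * S.card * maxDist a S V ^ 2 := by
    rw [← Real.sq_sqrt (show 0 ≤ δ ^ 2 / 2 + 2 * S.card * maxDist a S V ^ 2 by positivity)]
    exact pow_le_pow_left₀ (maxDist_nonneg _ _ _) hm 2
  have hδ2 : δ ^ 2 ≤ maxDist a Finset.univ V ^ 2 := pow_le_pow_left₀ hδ.le hδm.le 2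
  refine (sq_le_sq₀ (maxDist_nonneg _ _ _) (by positivity)).1 ?_
  rw [mul_pow, mul_pow, Real.sq_sqrt (Nat.cast_nonneg _)]
  linarith

/-! ### The rank of the coreset -/

theorem exists_finrank_eq_of_le {d k : ℕ} (hkd : k ≤ d)
    (U : Submodule ℝ (EuclideanSpace ℝ (Fin d))) (hU : Module.finrank ℝ U ≤ k) :
    ∃ V, U ≤ V ∧ Module.finrank ℝ V = k := by
  induction k, hU using Nat.le_induction with
  | base => exact ⟨U, le_rfl, rfl⟩
  | succ k hU ih =>
    obtain ⟨V, hUV, hV⟩ := ih (by omega)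
    have hne : V ≠ ⊤ := by
      rintro rfl
      rw [finrank_top, finrank_euclideanSpace_fin] at hV
      omega
    obtain ⟨x, -, hx⟩ := SetLike.exists_of_lt (lt_top_iff_ne_top.2 hne)
    refine ⟨V ⊔ Submodule.span ℝ {x}, hUV.trans le_sup_left, le_antisymm ?_ ?_⟩
    · refine (Submodule.finrank_add_le_finrank_add_finrank _ _).trans ?_
      have := finrank_span_le_card (R := ℝ) ({x} : Set (EuclideanSpace ℝ (Fin d)))
      simp only [Set.toFinset_singleton, Finset.card_singleton] at this
      omega
    · have hlt : V < V ⊔ Submodule.span ℝ {x} :=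
        lt_of_le_of_ne le_sup_left fun h => hx (h ▸
          Submodule.mem_sup_right (Submodule.mem_span_singleton_self x))
      have := Submodule.finrank_lt_finrank_of_lt hlt
      omega

theorem lt_of_optCost_pos {d n k : ℕ} (hkd : k ≤ d) (a : Fin n → EuclideanSpace ℝ (Fin d))
    (h : 0 < optCost k a) : k < d := by
  refine lt_of_le_of_ne hkd ?_
  rintro rfl
  have h1 := h.trans_le (optCost_le_maxDist a ⊤ (by simp))
  refine h1.ne' (le_antisymm (Real.iSup_le (fun i => ?_) le_rfl) (maxDist_nonneg _ _ _))
  exact (Metric.infDist_zero_of_mem (by simp)).le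

/-- Otherwise a `k`-dimensional `V` contains every selected row, and the multiplicative bound forces
the cost of `V` to be `0`. This lets `|S|` pay for the `k + 1` prefix rows in memory. -/
theorem lt_card_coreset {d n k : ℕ} (hk : 1 ≤ k) (hkd : k < d)
    (a : Fin n → EuclideanSpace ℝ (Fin d)) {δ : ℝ} (hδ : 0 < δ) (hopt : δ < optCost k a) :
    k < (coreset k (δ / (2 * √((k : ℝ) + 1))) a).card := by
  classical
  by_contra! hle
  set S := coreset k (δ / (2 * √((k : ℝ) + 1))) a with hS
  obtain ⟨V, hUV, hV⟩ := exists_finrank_eq_of_le hkd.le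
    (Submodule.span ℝ (S.image a : Set (EuclideanSpace ℝ (Fin d))))
    ((finrank_span_finset_le_card _).trans (Finset.card_image_le.trans hle))
  have h1 := maxDist_le_two_mul_sqrt_card_mul hk hkd a hδ hopt V hV
  rw [← hS] at h1
  have h2 : maxDist a S V = 0 := by
    refine le_antisymm (Real.iSup_le (fun i => ?_) le_rfl) (maxDist_nonneg _ _ _)
    refine (Metric.infDist_zero_of_mem (hUV (Submodule.subset_span ?_))).le
    exact Finset.mem_coe.2 (Finset.mem_image_of_mem a i.2)
  rw [h2, mul_zero] at h1
  linarith [hopt.trans_le (optCost_le_maxDist a V hV)]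

/-- The distance to a subspace is at most the norm, so every cost is at most `δ` if `R ≤ δ`. -/
theorem lt_of_lt_optCost {d n k : ℕ} (hkd : k ≤ d) (a : Fin n → EuclideanSpace ℝ (Fin d)) {R δ : ℝ}
    (hδ : 0 < δ) (hopt : δ < optCost k a) (ha : ∀ i, ‖a i‖ < R) : δ < R := by
  obtain ⟨V, -, hV⟩ := exists_finrank_eq_of_le hkd (⊥ : Submodule ℝ (EuclideanSpace ℝ (Fin d)))
    (by simp)
  have h1 := hopt.trans_le (optCost_le_maxDist a V hV)
  by_contra! h
  refine absurd (h1.trans_le (Real.iSup_le (fun i => ?_) hδ.le)) (lt_irrefl δ)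
  have h2 := Metric.infDist_le_dist_of_mem (x := a i) V.zero_mem
  rw [dist_zero_right] at h2
  exact h2.trans ((ha i).le.trans h)

/-! ### Assembly of the size, quality and memory bounds -/

theorem mainTheorem4 :
    ∃ C : ℝ, 0 < C ∧
      ∀ (d n k : ℕ) (a : Fin n → EuclideanSpace ℝ (Fin d)) (R δ c : ℝ) (S : Finset (Fin n)),
        1 ≤ k → k ≤ d →
        0 < δ → δ < optCost k a →
        (∀ i, ‖a i‖ < R) →
        c = δ / (2 * √((k : ℝ) + 1)) →
        S = coreset k c a →
        (S.card : ℝ) ≤ C * k * (max 1 (Real.log (k * R / δ))) ^ 3 ∧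
        (∀ V : Submodule ℝ (EuclideanSpace ℝ (Fin d)), Module.finrank ℝ V = k →
          maxDist a Finset.univ V ≤
            C * √(k : ℝ) * (max 1 (Real.log (k * R / δ))) ^ (3 / 2 : ℝ) * maxDist a S V) ∧
        (∀ m : ℕ, ((run k ((prefixedStream k c a).take m)).words : ℝ) ≤ C * (S.card * d)) := by

  refine ⟨200, by norm_num, ?_⟩
  rintro d n k a R δ c S hk hkd' hδ hopt ha rfl rfl
  have hkd := lt_of_optCost_pos hkd' a (hδ.trans hopt)
  have hδR := lt_of_lt_optCost hkd' a hδ hopt ha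
  have hcard := card_coreset_le hk hkd a hδ hδR ha
  have hlt := lt_card_coreset hk hkd a hδ hopt
  have hmax := maxDist_le_two_mul_sqrt_card_mul hk hkd a hδ hopt
  have hc : δ / (2 * √((k : ℝ) + 1)) ≠ 0 := by positivity
  have hlen := length_stored hk hkd hc a
  set c := δ / (2 * √((k : ℝ) + 1))
  set S := coreset k c a
  set Lg := max 1 (Real.log (k * R / δ))
  have hL1 : 1 ≤ Lg := le_max_left _ _
  have hcard3 : (S.card : ℝ) ≤ 192 * k * Lg ^ 3 :=
    hcard.trans (mul_le_mul_of_nonneg_left (le_self_pow₀ hL1 (by norm_num)) (by positivity))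
  refine ⟨hcard3.trans (by gcongr; norm_num), fun V hV => (hmax V hV).trans ?_, fun m => ?_⟩
  · refine mul_le_mul_of_nonneg_right ?_ (maxDist_nonneg _ _ _)
    have h1 : (Lg ^ (3 / 2 : ℝ)) ^ 2 = Lg ^ 3 := by
      rw [← Real.rpow_natCast, ← Real.rpow_mul (by positivity), ← Real.rpow_natCast]
      norm_num
    refine (sq_le_sq₀ (by positivity) (by positivity)).1 ?_
    rw [mul_pow, mul_pow, mul_pow, h1, Real.sq_sqrt (Nat.cast_nonneg _),
      Real.sq_sqrt (Nat.cast_nonneg _)]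
    have : 0 ≤ k * Lg ^ 3 := by positivity
    -- After squaring, `4 * 192 ≤ 200 ^ 2` suffices.
    nlinarith
  · have h1 : (run k ((prefixedStream k c a).take m)).stored.length ≤ k + 1 + S.card := by
      rw [← hlen]
      conv_rhs => rw [← List.take_append_drop m (prefixedStream k c a)]
      exact (run_stored_prefix k _ _).length_le
    have h2 : (run k ((prefixedStream k c a).take m)).words ≤ 200 * (S.card * d) := by
      -- `k + 1 ≤ |S|` bounds the number of stored rows by `2 |S|`, and `d + 1 ≤ 2 d`.
      have h3 : (run k ((prefixedStream k c a).take m)).stored.length * (d + 1)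
          ≤ (2 * S.card) * (2 * d) := Nat.mul_le_mul (by omega) (by omega)
      have h4 : d ≤ S.card * d := Nat.le_mul_of_pos_left d (by omega)
      rw [CoresetState.words]
      nlinarith
    exact_mod_cast h2
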